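/- Let $(Q_n)_{n\ge 0}$ be the Yablonskii--Vorob'ev polynomials: $Q_0=1$, $Q_1=z$ and $$Q_{n+1}Q_{n-1}=zQ_n^2-4\bigl(Q_nQ_n''-(Q_n')^2\bigr)\qquad(n\ge 1).$$ This recurrence indeed determines polynomials $Q_n\in\mathbb{Q}[z]$, i.e. at each step the right-hand side is divisible by $Q_{n-1}$. For $n,m\ge 0$ put $$S_m(n)=\sum_{z\ne 0,\ Q_n(z)=0}\frac1{z^m},$$ the sum being over the nonzero complex roots of $Q_n$, counted with multiplicity. Then for all integers $n\ge 0$: $$S_3(n)=\begin{cases}\frac n4& n\equiv 0 \pmod 3,\\ 0& n\equiv 1\pmod 3,\\ -\frac{n+1}4& n\equiv 2\pmod 3,\end{cases}$$ $$S_6(n)=\begin{cases}\frac1{40}n^2+\frac1{80}n& n\equiv 0 \pmod 3,\\ -\frac1{560}n^2-\frac1{560}n+\frac1{280}& n\equiv 1\pmod 3,\\ \frac1{40}n^2+\frac3{80}n+\frac1{80}& n\equiv 2\pmod 3,\end{cases}$$ $$S_9(n)=\begin{cases}\frac{n+7n^2+10n^3}{4480}& n\equiv 0 \pmod 3,\\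 \frac{2-n-n^2}{22400}& n\equiv 1\pmod 3,\\ \frac{-20-85n-115n^2-50n^3}{22400}& n\equiv 2\pmod 3.\end{cases}$$ Moreover, for every positive multiple $m$ of $3$ and every $r\in\{0,1,2\}$ there is a polynomial $P_{m,r}$ with rational coefficients such that $S_m(n)=P_{m,r}(n)$ for all $n\ge 0$ with $n\equiv r\pmod 3$; for every $m\ge 0$ not divisible by $3$, $S_m(n)=0$ for all $n\ge0$. Consequently $S_m(n)\in\mathbb{Q}$ for all $n,m\ge 0$. -/

import Mathlib

open Polynomial

/-- The Yablonskii-Vorob'ev polynomials, as elements of `ℚ[X]`: `Q₀ = 1`, `Q₁ = X` and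
`Qₙ₊₂ = (X Qₙ₊₁² - 4 (Qₙ₊₁ Qₙ₊₁'' - (Qₙ₊₁')²)) / Qₙ`.
The slash is the quotient of polynomial division with remainder; that the remainder always
vanishes is part of the theorem. -/
noncomputable def yablonskiiVorobev : ℕ → ℚ[X]
  | 0 => 1
  | 1 => X
  | n + 2 =>
    (X * yablonskiiVorobev (n + 1) ^ 2
      - 4 * (yablonskiiVorobev (n + 1) * derivative (derivative (yablonskiiVorobev (n + 1)))
        - derivative (yablonskiiVorobev (n + 1)) ^ 2)) / yablonskiiVorobev n

/-- The sum of `1 / z ^ m` over all nonzero complex roots `z` of the `n`-th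
Yablonskii-Vorob'ev polynomial, each repeated according to its multiplicity. -/
noncomputable def inversePowerSum (n m : ℕ) : ℂ :=
  ((((yablonskiiVorobev n).aroots ℂ).filter (fun z : ℂ => z ≠ 0)).map
    (fun z : ℂ => 1 / z ^ m)).sum

/-! Write `u` for the logarithmic derivative of `g = Q_{n+1}` and `w` for that of `Q_n` minus `u`.
Then `w` solves Painlevé II with parameter `n + 1` and `u` is its Hamiltonian. The Toda recurrence
realises the Bäcklund transformation that raises the parameter by one (`IsPainlevePair.toda`), so
this structure propagates by induction from `w = -1/z`.

From it follow bilinear equations. A quartic one in a single `Q_n` forces all roots to be simple: at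
a root of multiplicity `k` its leading coefficient is `6k(k-1)`. With quadratic and cubic ones
linking neighbours, it makes `Q_n` divide `(Q_n')²` times the right-hand side of the recurrence.
Since `Q_n` is coprime to `Q_n'`, the division is exact (`dvd_toda`). Exactness is needed inside the
induction itself, because the next polynomial is defined as a Euclidean quotient.

Apart from the term `1/z` when `Q_n(0) = 0`, the expansion of `Q_n'/Q_n` at `0` is `-∑ S_{m+1}(n)
z^m`. Invariance of the roots under cube roots of unity kills `S_m` for `3 ∤ m`, and with simplicity
it gives a zero at the origin exactly for `n ≡ 1` mod 3. The quartic equation becomes an ODE whose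
coefficient recursion does not involve `n`, so each coefficient is polynomial in `n` once the free
ones are.

The free coefficient is `z^2` for `n ≢ 1`, and `z^5`, a resonance, for `n ≡ 1`. The sigma form, a
second-order equation containing `n(n+1)`, determines the latter and leaves two values for the
former. The cubic relation between `Q_n` and `Q_{n+1}` for `n ≡ 2` selects the right one. -/

/-! ### Extending the derivative to rational functions. -/

section Fractions
open TrivSqZeroExt

/-- The formal derivative of polynomials extends to the field of fractions. -/
theorem exists_derivation_extending_derivative (F K : Type*) [Field F] [Field K] [Algebra F[X] K]
    [IsFractionRing F[X] K] :
    ∃ D : Derivation ℤ K K, ∀ p : F[X], D (algebraMap F[X] K p) = algebraMap F[X] K (derivative p) := by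
  obtain ⟨ι, hι⟩ : ∃ ι : F[X] →+* K, ι = algebraMap F[X] K := ⟨_, rfl⟩
  -- A derivation is the infinitesimal part of a ring map to the dual numbers: `p ↦ p + p'ε` inverts
  -- nonzero polynomials, hence extends to `K`.
  let φ : F[X] →+* TrivSqZeroExt K K :=
    { toFun := fun p => inl (ι p) + inr (ι (derivative p))
      map_one' := by ext <;> simp
      map_zero' := by ext <;> simp
      map_add' := fun p q => by ext <;> simp only [map_add, fst_add, snd_add, fst_inl, fst_inr,
        snd_inl, snd_inr] <;> ring
      map_mul' := fun p q => by
        ext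
        · simp
        · simp only [map_mul, map_add, derivative_mul, snd_mul, fst_add, snd_add, fst_inl, fst_inr,
            snd_inl, snd_inr, smul_eq_mul, op_smul_eq_mul]
          ring }
  have hφ1 : ∀ p, (φ p).fst = ι p := fun p => by simp [φ]
  have hφ2 : ∀ p, (φ p).snd = ι (derivative p) := fun p => by simp [φ]
  have hφ : ∀ y : nonZeroDivisors F[X], IsUnit (φ y) := fun y => by
    rw [isUnit_iff_isUnit_fst, hφ1, hι]
    exact IsLocalization.map_units K y
  obtain ⟨ψ, hψ⟩ : ∃ ψ : K →+* TrivSqZeroExt K K, ∀ p, ψ (ι p) = φ p :=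
    ⟨IsLocalization.lift hφ, fun p => by rw [hι]; exact IsLocalization.lift_eq hφ p⟩
  have hfst : ∀ x, (ψ x).fst = x := by
    have : ((fstHom K K K).toRingHom.comp ψ) = RingHom.id K := by
      apply IsLocalization.ringHom_ext (nonZeroDivisors F[X])
      rw [← hι]
      refine RingHom.ext fun p => ?_
      change (ψ (ι p)).fst = ι p
      rw [hψ, hφ1]
    exact fun x => congrArg (fun g : K →+* K => g x) this
  let L : K →ₗ[ℤ] K := AddMonoidHom.toIntLinearMap
    { toFun := fun x => (ψ x).snd
      map_zero' := by rw [map_zero, snd_zero]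
      map_add' := fun x y => by rw [map_add, snd_add] }
  refine ⟨Derivation.mk' L fun x y => ?_, fun p => ?_⟩
  · change (ψ (x * y)).snd = x • (ψ y).snd + y • (ψ x).snd
    rw [map_mul, snd_mul, hfst, hfst]
    simp only [smul_eq_mul, op_smul_eq_mul, mul_comm]
  · change (ψ _).snd = _
    rw [← hι, hψ, hφ2]

end Fractions

/-! ### Painlevé II pairs and the Bäcklund transformation. -/

theorem derivation_two {K : Type*} [CommRing K] (D : Derivation ℤ K K) : D 2 = 0 :=
  mod_cast D.map_natCast 2

/-- Two functions `f`, `g` with logarithmic derivatives `u + w` and `u`, such that `w` solves the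
second Painlevé equation with parameter `n` and `u` is the associated Hamiltonian. -/
structure IsPainlevePair {K : Type*} [Field K] (D : Derivation ℤ K K) (z n f g u w : K) : Prop where
  left_ne_zero : f ≠ 0
  right_ne_zero : g ≠ 0
  deriv_left : D f = f * (u + w)
  deriv_right : D g = g * u
  painleve : D (D w) = 2 * w ^ 3 + z * w + n
  hamiltonian : 2 * u = D w ^ 2 - w ^ 4 - z * w ^ 2 - (2 * n + 1) * w

namespace IsPainlevePair

variable {K : Type*} [Field K] [CharZero K] {D : Derivation ℤ K K} {z n f g u w : K}

/-- Differentiate the Hamiltonian; substituting Painlevé II for `D (D w)` cancels everything except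
the explicit `z`-derivative and one multiple of `D w`. -/
theorem deriv_u (h : IsPainlevePair D z n f g u w) (hz : D z = 1) (hn : D n = 0) :
    D u = -(w ^ 2 + D w) / 2 := by
  have h1 := congrArg D h.hamiltonian
  simp only [Derivation.leibniz, Derivation.leibniz_pow, map_sub, map_add, derivation_two, hz, hn,
    Derivation.map_one_eq_zero, smul_eq_mul, h.painleve, nsmul_eq_mul] at h1
  push_cast at h1
  linear_combination h1 / 2

theorem deriv_deriv_u (h : IsPainlevePair D z n f g u w) (hz : D z = 1) (hn : D n = 0) :
    D (D u) = -(2 * w * D w + 2 * w ^ 3 + z * w + n) / 2 := by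
  have h1 := congrArg (fun x => D (2 * x)) (h.deriv_u hz hn)
  rw [show 2 * (-(w ^ 2 + D w) / 2) = -(w ^ 2 + D w) by ring] at h1
  simp only [Derivation.leibniz, Derivation.leibniz_pow, map_neg, map_add, derivation_two,
    smul_eq_mul, h.painleve, nsmul_eq_mul] at h1
  push_cast at h1
  linear_combination h1 / 2

theorem deriv_deriv_deriv_u (h : IsPainlevePair D z n f g u w) (hz : D z = 1) (hn : D n = 0) :
    D (D (D u)) = -(2 * D w ^ 2 + 2 * w * (2 * w ^ 3 + z * w + n) + 6 * w ^ 2 * D w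
      + z * D w + w) / 2 := by
  have h1 := congrArg (fun x => D (2 * x)) (h.deriv_deriv_u hz hn)
  rw [show ∀ x : K, 2 * (-x / 2) = -x by intro x; ring] at h1
  simp only [Derivation.leibniz, Derivation.leibniz_pow, map_neg, map_add, derivation_two,
    smul_eq_mul, h.painleve, nsmul_eq_mul, hz, hn] at h1
  push_cast at h1
  linear_combination h1 / 2

/-- The Bäcklund transformation, realised by the Toda equation. -/
theorem toda (h : IsPainlevePair D z n f g u w) (hz : D z = 1) (hn : D n = 0)
    (hn' : 2 * n + 1 ≠ 0) :
    ∃ u' w', IsPainlevePair D z (n + 1) g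
      ((z * g ^ 2 - 4 * (g * D (D g) - D g ^ 2)) / f) u' w' := by
  -- The Toda numerator is `φ g²`, because `g D(Dg) - (Dg)² = g² Du` and `2 Du = -(w² + Dw)`.
  obtain ⟨φ, hφ⟩ : ∃ φ, φ = z + 2 * w ^ 2 + 2 * D w := ⟨_, rfl⟩
  have hDφ : D φ = 2 * w * φ + (2 * n + 1) := by
    rw [hφ]
    simp only [Derivation.leibniz, Derivation.leibniz_pow, map_add, derivation_two,
      smul_eq_mul, h.painleve, nsmul_eq_mul, hz]
    push_cast
    ring
  have hφ0 : φ ≠ 0 := by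
    rintro h0
    rw [h0, map_zero] at hDφ
    exact hn' (by linear_combination -hDφ)
  have hf := h.left_ne_zero
  have hg := h.right_ne_zero
  obtain ⟨c, hc⟩ : ∃ c, c = (2 * n + 1) / φ := ⟨_, rfl⟩
  have hcφ : c * φ = 2 * n + 1 := by rw [hc]; field_simp
  have hDc : D c = -2 * w * c - c ^ 2 := by
    have h1 := congrArg D hcφ
    simp only [Derivation.leibniz, map_add, derivation_two, smul_eq_mul, hn, hDφ,
      Derivation.map_one_eq_zero] at h1
    apply mul_right_cancel₀ hφ0
    linear_combination h1 + c * hcφ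
  have hDDg : D (D g) = g * (u ^ 2 + D u) := by
    rw [h.deriv_right, Derivation.leibniz, h.deriv_right]
    simp only [smul_eq_mul]; ring
  have hh : (z * g ^ 2 - 4 * (g * D (D g) - D g ^ 2)) / f = φ * g ^ 2 / f := by
    rw [hDDg, h.deriv_right, h.deriv_u hz hn, hφ]
    ring
  rw [hh]
  obtain ⟨k, hk⟩ : ∃ k, k = φ * g ^ 2 / f := ⟨_, rfl⟩
  rw [← hk]
  have hkf : k * f = φ * g ^ 2 := by rw [hk]; field_simp
  have hDw' : D (-w - c) = -D w + 2 * w * c + c ^ 2 := by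
    rw [map_sub, map_neg, hDc]; ring
  -- The classical Bäcklund formula `w' = -w - (2n+1)/φ`. The new `u'` must satisfy `u' + w' = u`,
  -- since `g` is now the left member.
  refine ⟨u - (-w - c), -w - c, hg, ?_, ?_, ?_, ?_, ?_⟩
  · rw [hk]; positivity
  · rw [h.deriv_right]; ring
  · have h1 := congrArg D hkf
    simp only [Derivation.leibniz, Derivation.leibniz_pow, smul_eq_mul, nsmul_eq_mul, hDφ,
      h.deriv_right, h.deriv_left] at h1
    push_cast at h1
    apply mul_right_cancel₀ hf
    linear_combination h1 - g ^ 2 * hcφ - (2 * u + 2 * w + c) * hkf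
  · rw [hDw']
    simp only [map_add, map_neg, Derivation.leibniz, Derivation.leibniz_pow, smul_eq_mul,
      nsmul_eq_mul, hDc, derivation_two, h.painleve]
    push_cast
    subst hφ
    linear_combination (1 : K) * hcφ
  · rw [hDw']
    subst hφ
    linear_combination h.hamiltonian + (c + 2 * w) * hcφ

end IsPainlevePair

/-! ### Higher derivatives in terms of the logarithmic derivative. -/

section LogDerivative

variable {A R : Type*} [CommRing A] [CommRing R] [Algebra A R] {D : Derivation A R R} {g u : R}

theorem deriv_two_of_log_deriv (h : D g = g * u) : D (D g) = g * (u ^ 2 + D u) := by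
  rw [h, D.leibniz, h]
  simp only [smul_eq_mul]; ring

theorem deriv_three_of_log_deriv (h : D g = g * u) :
    D (D (D g)) = g * (u ^ 3 + 3 * (u * D u) + D (D u)) := by
  rw [deriv_two_of_log_deriv h, D.leibniz, h, map_add, D.leibniz_pow]
  simp only [smul_eq_mul, nsmul_eq_mul]; push_cast; ring

theorem deriv_four_of_log_deriv (h : D g = g * u) :
    D (D (D (D g))) = g * (u ^ 4 + 6 * u ^ 2 * D u + 4 * (u * D (D u)) + 3 * D u ^ 2
      + D (D (D u))) := by
  have h3 : D (3 * (u * D u)) = 3 * D (u * D u) := by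
    rw [show (3 : R) * (u * D u) = (3 : ℕ) • (u * D u) by simp, map_nsmul, nsmul_eq_mul]; rfl
  rw [deriv_three_of_log_deriv h, D.leibniz, h, map_add, map_add, D.leibniz_pow, h3, D.leibniz]
  simp only [smul_eq_mul, nsmul_eq_mul]; push_cast; ring

end LogDerivative

/-! ### Bilinear equations and the sigma form. -/

namespace IsPainlevePair

variable {K : Type*} [Field K] [CharZero K] {D : Derivation ℤ K K} {z n f g u w : K}

theorem deriv_add (h : IsPainlevePair D z n f g u w) (hz : D z = 1) (hn : D n = 0) :
    D (u + w) = (D w - w ^ 2) / 2 := by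
  rw [map_add, h.deriv_u hz hn]; ring

theorem deriv_deriv_add (h : IsPainlevePair D z n f g u w) (hz : D z = 1) (hn : D n = 0) :
    D (D (u + w)) = (2 * w ^ 3 + z * w + n - 2 * w * D w) / 2 := by
  rw [map_add, map_add, h.deriv_deriv_u hz hn, h.painleve]; ring

/-- Divided by `f g`, this is `D (u + w) + D u + w ^ 2 = 0`. -/
theorem bilinear_two (h : IsPainlevePair D z n f g u w) (hz : D z = 1) (hn : D n = 0) :
    D (D f) * g - 2 * (D f * D g) + f * D (D g) = 0 := by
  rw [deriv_two_of_log_deriv h.deriv_left, deriv_two_of_log_deriv h.deriv_right, h.deriv_left,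
    h.deriv_right, h.deriv_add hz hn, h.deriv_u hz hn]
  ring

theorem bilinear_three (h : IsPainlevePair D z n f g u w) (hz : D z = 1) (hn : D n = 0) :
    D (D (D f)) * g - 3 * (D (D f) * D g) + 3 * (D f * D (D g)) - f * D (D (D g)) =
      z * (D f * g - f * D g) + n * (f * g) := by
  rw [deriv_three_of_log_deriv h.deriv_left, deriv_three_of_log_deriv h.deriv_right,
    deriv_two_of_log_deriv h.deriv_left, deriv_two_of_log_deriv h.deriv_right, h.deriv_left,
    h.deriv_right, h.deriv_deriv_add hz hn, h.deriv_add hz hn, h.deriv_deriv_u hz hn,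
    h.deriv_u hz hn]
  ring

/-- Divided by `g²`, this is `u''' + 6u'² = (zu)'`: an equation for `g` alone that does not contain
the parameter. -/
theorem bilinear_four (h : IsPainlevePair D z n f g u w) (hz : D z = 1) (hn : D n = 0) :
    g * D (D (D (D g))) - 4 * (D g * D (D (D g))) + 3 * D (D g) ^ 2 =
      z * (g * D (D g) - D g ^ 2) + g * D g := by
  rw [deriv_four_of_log_deriv h.deriv_right, deriv_three_of_log_deriv h.deriv_right,
    deriv_two_of_log_deriv h.deriv_right,
    h.deriv_right, h.deriv_deriv_deriv_u hz hn, h.deriv_deriv_u hz hn, h.deriv_u hz hn]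
  linear_combination (-g ^ 2 / 2) * h.hamiltonian

/-- Eliminating `w` between the Hamiltonian and the formulas for `u'`, `u''` gives a second-order
equation for `u` that, unlike `bilinear_four`, retains the parameter. It is cleared of denominators
by `g ^ 6`. -/
theorem sigma_form (h : IsPainlevePair D z n f g u w) (hz : D z = 1) (hn : D n = 0) :
    16 * (g * D (D g) - D g ^ 2) ^ 3
      + 4 * (g ^ 2 * D (D (D g)) - 3 * (g * D g * D (D g)) + 2 * D g ^ 3) ^ 2
      - 2 * g ^ 3 * (g ^ 2 * D (D (D g)) - 3 * (g * D g * D (D g)) + 2 * D g ^ 3) =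
    4 * z * g ^ 2 * (g * D (D g) - D g ^ 2) ^ 2 + 8 * g ^ 3 * D g * (g * D (D g) - D g ^ 2)
      - 2 * z * g ^ 5 * D g + n * (n + 1) * g ^ 6 := by
  have h1 : g * D (D g) - D g ^ 2 = g ^ 2 * D u := by
    rw [deriv_two_of_log_deriv h.deriv_right, h.deriv_right]; ring
  have h2 : g ^ 2 * D (D (D g)) - 3 * (g * D g * D (D g)) + 2 * D g ^ 3 = g ^ 3 * D (D u) := by
    rw [deriv_three_of_log_deriv h.deriv_right, deriv_two_of_log_deriv h.deriv_right,
      h.deriv_right]; ring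
  rw [h1, h2, h.deriv_right, h.deriv_deriv_u hz hn, h.deriv_u hz hn]
  linear_combination (g ^ 6 * (z + 2 * w ^ 2 + 2 * D w)) * h.hamiltonian

end IsPainlevePair

/-! ### Simple roots and exact division. -/

section SimpleRoots

variable {F : Type*} [Field F] [CharZero F]

/-- Multiplying by `X - a` after each differentiation keeps the factor `(X - a) ^ k` intact.
Iterated from `j = 0`, the cofactor at `a` picks up the falling factorials of `k`. -/
theorem X_sub_C_pow_succ_mul_derivative {a : F} {q r : F[X]} {j k : ℕ}
    (h : ((X - C a) ^ j * q : F[X]) = (X - C a) ^ k * r) :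
    (X - C a) ^ (j + 1) * derivative q =
      (X - C a) ^ k * (((k : F[X]) - (j : F[X])) * r + (X - C a) * derivative r) := by
  have hp : ∀ m : ℕ, (X - C a) * derivative ((X - C a) ^ m) = (m : F[X]) * (X - C a) ^ m := fun m => by
    rcases m with _ | m
    · simp
    · rw [derivative_X_sub_C_pow, Nat.add_sub_cancel, pow_succ, map_natCast]; ring
  have h1 := congrArg derivative h
  rw [derivative_mul, derivative_mul] at h1
  linear_combination (X - C a) * h1 - q * hp j + r * hp k - (j : F[X]) * h

/-- Every root of a nonzero polynomial solving this bilinear differential equation is simple. -/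
theorem eval_derivative_ne_zero_of_bilinear_four {p : F[X]} (hp : p ≠ 0)
    (h : p * derivative (derivative (derivative (derivative p)))
      - 4 * (derivative p * derivative (derivative (derivative p)))
      + 3 * derivative (derivative p) ^ 2 =
        X * (p * derivative (derivative p) - derivative p ^ 2) + p * derivative p)
    {a : F} (ha : p.eval a = 0) : (derivative p).eval a ≠ 0 := by
  intro ha'
  obtain ⟨r, hr, hra⟩ := exists_eq_pow_rootMultiplicity_mul_and_not_dvd p hp a
  obtain ⟨k, hk⟩ : ∃ k, k = rootMultiplicity a p := ⟨_, rfl⟩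
  rw [← hk] at hr
  have hk1 : 1 < k := hk ▸ (one_lt_rootMultiplicity_iff_isRoot (p := p) hp).2 ⟨ha, ha'⟩
  rw [dvd_iff_isRoot, IsRoot.def] at hra
  obtain ⟨t, ht⟩ : ∃ t, t = X - C a := ⟨_, rfl⟩
  have h0 : (X - C a) ^ 0 * p = (X - C a) ^ k * r := by rw [pow_zero, one_mul, ← hr]
  have h1 := X_sub_C_pow_succ_mul_derivative h0
  have h2 := X_sub_C_pow_succ_mul_derivative h1
  have h3 := X_sub_C_pow_succ_mul_derivative h2
  have h4 := X_sub_C_pow_succ_mul_derivative h3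
  obtain ⟨r1, hr1⟩ : ∃ q, q = ((k : F[X]) - ((0 : ℕ) : F[X])) * r + (X - C a) * derivative r := ⟨_, rfl⟩
  rw [← hr1] at h1 h2 h3 h4
  obtain ⟨r2, hr2⟩ : ∃ q, q = ((k : F[X]) - ((0 + 1 : ℕ) : F[X])) * r1 + (X - C a) * derivative r1 :=
    ⟨_, rfl⟩
  rw [← hr2] at h2 h3 h4
  obtain ⟨r3, hr3⟩ : ∃ q, q = ((k : F[X]) - ((0 + 1 + 1 : ℕ) : F[X])) * r2 + (X - C a) * derivative r2 :=
    ⟨_, rfl⟩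
  rw [← hr3] at h3 h4
  obtain ⟨r4, hr4⟩ : ∃ q, q = ((k : F[X]) - ((0 + 1 + 1 + 1 : ℕ) : F[X])) * r3 + (X - C a) * derivative r3 :=
    ⟨_, rfl⟩
  rw [← hr4] at h4
  have e1 : r1.eval a = k * r.eval a := by simp [hr1]
  have e2 : r2.eval a = (k - 1) * r1.eval a := by simp [hr2]
  have e3 : r3.eval a = (k - 2) * r2.eval a := by simp [hr3]
  have e4 : r4.eval a = (k - 3) * r3.eval a := by simp [hr4]
  rw [← ht] at h0 h1 h2 h3 h4
  have key : (t ^ k) ^ 2 * (r * r4 - 4 * (r1 * r3) + 3 * r2 ^ 2) =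
      (t ^ k) ^ 2 * (t ^ 2 * (X * (r * r2 - r1 ^ 2)) + t ^ 3 * (r * r1)) := by
    have g0 : p = t ^ k * r := by rw [← h0]; ring
    have g1 : t * derivative p = t ^ k * r1 := by rw [← h1]; ring
    have g2 : t ^ 2 * derivative (derivative p) = t ^ k * r2 := by rw [← h2]
    have g3 : t ^ 3 * derivative (derivative (derivative p)) = t ^ k * r3 := by rw [← h3]
    have g4 : t ^ 4 * derivative (derivative (derivative (derivative p))) = t ^ k * r4 := by
      rw [← h4]
    calc _ = (t ^ k * r) * (t ^ k * r4) - 4 * ((t ^ k * r1) * (t ^ k * r3))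
          + 3 * (t ^ k * r2) ^ 2 := by ring
      _ = t ^ 2 * (X * ((t ^ k * r) * (t ^ k * r2) - (t ^ k * r1) ^ 2))
          + t ^ 3 * ((t ^ k * r) * (t ^ k * r1)) := by
        rw [← g4, ← g3, ← g2, ← g1, ← g0]
        linear_combination t ^ 4 * h
      _ = _ := by ring
  have ht0 : t ≠ 0 := ht ▸ X_sub_C_ne_zero a
  have key2 := congrArg (eval a) (mul_left_cancel₀ (pow_ne_zero 2 (pow_ne_zero k ht0)) key)
  have hta : t.eval a = 0 := by simp [ht]
  simp only [eval_add, eval_sub, eval_mul, eval_pow, eval_ofNat, hta, e4, e3, e2, e1] at key2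
  -- The falling factorials combine to `6k(k-1)`; the right-hand side carries at least two further
  -- factors `X - a` and drops out.
  have h6 : (6 : F) * k * (k - 1) * (r.eval a) ^ 2 = 0 := by linear_combination key2
  have hk0 : (k : F) ≠ 0 := by exact_mod_cast (by omega : k ≠ 0)
  have hk1' : (k : F) - 1 ≠ 0 := sub_ne_zero.2 (by exact_mod_cast (by omega : k ≠ 1))
  simp [hk0, hk1', hra] at h6

theorem isCoprime_derivative_of_bilinear_four {p : F[X]} (hp : p ≠ 0)
    (h : p * derivative (derivative (derivative (derivative p)))
      - 4 * (derivative p * derivative (derivative (derivative p)))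
      + 3 * derivative (derivative p) ^ 2 =
        X * (p * derivative (derivative p) - derivative p ^ 2) + p * derivative p) :
    IsCoprime p (derivative p) := by
  rw [isCoprime_iff_aeval_ne_zero_of_isAlgClosed F (AlgebraicClosure F)]
  intro a
  by_contra! H
  have hι := (algebraMap F (AlgebraicClosure F)).injective
  have h' := congrArg (Polynomial.map (algebraMap F (AlgebraicClosure F))) h
  simp only [Polynomial.map_add, Polynomial.map_sub, Polynomial.map_mul, Polynomial.map_pow,
    ← derivative_map, map_X, Polynomial.map_ofNat] at h'
  refine eval_derivative_ne_zero_of_bilinear_four ((Polynomial.map_ne_zero_iff hι).2 hp) h'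
    (a := a) ?_ ?_
  · rw [eval_map_algebraMap]; exact H.1
  · rw [derivative_map, eval_map_algebraMap]; exact H.2

/-- The divisibility that makes the quotient in the recurrence exact. -/
theorem dvd_toda {f g c : F[X]} (hf : f ≠ 0)
    (h2 : derivative (derivative f) * g - 2 * (derivative f * derivative g)
      + f * derivative (derivative g) = 0)
    (h3 : derivative (derivative (derivative f)) * g
      - 3 * (derivative (derivative f) * derivative g)
      + 3 * (derivative f * derivative (derivative g))
      - f * derivative (derivative (derivative g)) =
        X * (derivative f * g - f * derivative g) + c * (f * g))
    (h4 : f * derivative (derivative (derivative (derivative f)))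
      - 4 * (derivative f * derivative (derivative (derivative f)))
      + 3 * derivative (derivative f) ^ 2 =
        X * (f * derivative (derivative f) - derivative f ^ 2) + f * derivative f) :
    f ∣ X * g ^ 2 - 4 * (g * derivative (derivative g) - derivative g ^ 2) := by
  have hco := isCoprime_derivative_of_bilinear_four hf h4
  refine (hco.pow_right (n := 2)).dvd_of_dvd_mul_left ?_
  have h3u : IsUnit (3 : F[X]) := by
    rw [← map_ofNat C 3, isUnit_C]; exact (by norm_num : (3 : F) ≠ 0).isUnit
  -- Modulo `f`, `h2` gives `f''g = 2f'g'`. Using this and `h3` to eliminate `f''` and `f'''` from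
  -- `g² · h4` leaves `3f'²` times the target, whence the unit `3`.
  rw [← h3u.dvd_mul_left]
  refine ⟨g ^ 2 * (derivative (derivative (derivative (derivative f)))
    - X * derivative (derivative f) - derivative f)
    - 4 * derivative f * g * (c * g - X * derivative g + derivative (derivative (derivative g)))
    + 3 * f * derivative (derivative g) ^ 2, ?_⟩
  linear_combination (-3 * (derivative (derivative f) * g + f * derivative (derivative g)
    + 2 * (derivative f * derivative g)) + 6 * derivative (derivative f) * g) * h2
    - 4 * derivative f * g * h3 - g ^ 2 * h4

end SimpleRoots

/-! ### The induction along the sequence. -/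

section YablonskiiVorobev

theorem exists_field_derivation_extending_derivative :
    ∃ (K : Type) (_ : Field K) (_ : CharZero K) (_ : Algebra ℚ[X] K) (_ : IsFractionRing ℚ[X] K)
      (D : Derivation ℤ K K), ∀ p : ℚ[X], D (algebraMap ℚ[X] K p) = algebraMap ℚ[X] K (derivative p) :=
  ⟨FractionRing ℚ[X], inferInstance, algebraRat.charZero _, inferInstance, inferInstance,
    exists_derivation_extending_derivative ℚ (FractionRing ℚ[X])⟩

/-- The three claims need one another: exact division at `n` uses the pair and the quartic equation
for `Q_n`. It identifies the Euclidean quotient with the Toda quotient, which yields the next pair,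
while the current pair yields the quartic equation for `Q_{n+1}`. -/
theorem yablonskiiVorobev_pair {K : Type*} [Field K] [CharZero K] [Algebra ℚ[X] K]
    [IsFractionRing ℚ[X] K] {D : Derivation ℤ K K} 
    (hD : ∀ p : ℚ[X], D (algebraMap ℚ[X] K p) = algebraMap ℚ[X] K (derivative p))
    (n : ℕ) :
    (∃ u w, IsPainlevePair D (algebraMap ℚ[X] K X) ((n : K) + 1) (algebraMap ℚ[X] K (yablonskiiVorobev n))
      (algebraMap ℚ[X] K (yablonskiiVorobev (n + 1))) u w) ∧
    (yablonskiiVorobev n * derivative (derivative (derivative (derivative (yablonskiiVorobev n))))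
      - 4 * (derivative (yablonskiiVorobev n) *
        derivative (derivative (derivative (yablonskiiVorobev n))))
      + 3 * derivative (derivative (yablonskiiVorobev n)) ^ 2 =
        X * (yablonskiiVorobev n * derivative (derivative (yablonskiiVorobev n))
          - derivative (yablonskiiVorobev n) ^ 2)
        + yablonskiiVorobev n * derivative (yablonskiiVorobev n)) ∧
    yablonskiiVorobev (n + 2) * yablonskiiVorobev n =
      X * yablonskiiVorobev (n + 1) ^ 2
        - 4 * (yablonskiiVorobev (n + 1) * derivative (derivative (yablonskiiVorobev (n + 1)))
          - derivative (yablonskiiVorobev (n + 1)) ^ 2) := by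
  have hι : Function.Injective (algebraMap ℚ[X] K) := IsFractionRing.injective ℚ[X] K
  have hz : D (algebraMap ℚ[X] K X) = 1 := by rw [hD, derivative_X, map_one]
  have hDn : ∀ n : ℕ, D ((n : K) + 1) = 0 := fun n => by
    rw [map_add, D.map_natCast, Derivation.map_one_eq_zero, add_zero]
  have exact_div : ∀ n : ℕ, ∀ u w, IsPainlevePair D (algebraMap ℚ[X] K X) ((n : K) + 1) (algebraMap ℚ[X] K (yablonskiiVorobev n))
      (algebraMap ℚ[X] K (yablonskiiVorobev (n + 1))) u w →
      (yablonskiiVorobev n * derivative (derivative (derivative (derivative (yablonskiiVorobev n))))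
      - 4 * (derivative (yablonskiiVorobev n) *
        derivative (derivative (derivative (yablonskiiVorobev n))))
      + 3 * derivative (derivative (yablonskiiVorobev n)) ^ 2 =
        X * (yablonskiiVorobev n * derivative (derivative (yablonskiiVorobev n))
          - derivative (yablonskiiVorobev n) ^ 2)
        + yablonskiiVorobev n * derivative (yablonskiiVorobev n)) →
      yablonskiiVorobev (n + 2) * yablonskiiVorobev n =
      X * yablonskiiVorobev (n + 1) ^ 2
        - 4 * (yablonskiiVorobev (n + 1) * derivative (derivative (yablonskiiVorobev (n + 1)))
          - derivative (yablonskiiVorobev (n + 1)) ^ 2) := by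
    intro n u w h h4
    have h0 : yablonskiiVorobev n ≠ 0 := fun h0 => h.left_ne_zero (by rw [h0, map_zero])
    have h2 := h.bilinear_two hz (hDn n)
    have h3 := h.bilinear_three hz (hDn n)
    simp only [hD] at h2 h3
    rw [yablonskiiVorobev, mul_comm]
    refine EuclideanDomain.mul_div_cancel' h0 (dvd_toda (c := (n : ℚ[X]) + 1) h0 (hι ?_) (hι ?_) h4)
    · simpa only [map_add, map_sub, map_mul, map_ofNat, map_zero] using h2
    · simpa only [map_add, map_sub, map_mul, map_ofNat, map_natCast, map_one] using h3
  induction n with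
  | zero =>
    have h : IsPainlevePair D (algebraMap ℚ[X] K X) (((0 : ℕ) : K) + 1) (algebraMap ℚ[X] K (yablonskiiVorobev 0))
        (algebraMap ℚ[X] K (yablonskiiVorobev (0 + 1))) (1 / algebraMap ℚ[X] K X) (-(1 / algebraMap ℚ[X] K X)) := by
      have hX : algebraMap ℚ[X] K X ≠ 0 := by simp
      have hDX : D (1 / algebraMap ℚ[X] K X) = -(1 / algebraMap ℚ[X] K X) ^ 2 := by
        rw [one_div, Derivation.leibniz_inv, hz, smul_eq_mul]; ring
      have hDDX : D (-(1 / algebraMap ℚ[X] K X) ^ 2) = 2 * (1 / algebraMap ℚ[X] K X) ^ 3 := by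
        rw [map_neg, Derivation.leibniz_pow, hDX, nsmul_eq_mul, smul_eq_mul]; push_cast; ring
      simp only [yablonskiiVorobev, map_one]
      refine ⟨one_ne_zero, hX, ?_, ?_, ?_, ?_⟩
      · simp
      · rw [hz]; field_simp
      · rw [map_neg, map_neg, hDX, hDDX]; field_simp; push_cast; ring
      · rw [map_neg, hDX]; push_cast; field_simp; ring
    have h4 : (yablonskiiVorobev 0 *
      derivative (derivative (derivative (derivative (yablonskiiVorobev 0))))
      - 4 * (derivative (yablonskiiVorobev 0) *
        derivative (derivative (derivative (yablonskiiVorobev 0))))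
      + 3 * derivative (derivative (yablonskiiVorobev 0)) ^ 2 =
        X * (yablonskiiVorobev 0 * derivative (derivative (yablonskiiVorobev 0))
          - derivative (yablonskiiVorobev 0) ^ 2)
        + yablonskiiVorobev 0 * derivative (yablonskiiVorobev 0)) := by
      simp [yablonskiiVorobev]
    exact ⟨⟨_, _, h⟩, h4, exact_div 0 _ _ h h4⟩
  | succ n ih =>
    obtain ⟨⟨u, w, h⟩, -, hrec⟩ := ih
    obtain ⟨u', w', h'⟩ := h.toda hz (hDn n) (by
      exact_mod_cast (by omega : 2 * (n + 1) + 1 ≠ 0))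
    have hq : (algebraMap ℚ[X] K X * algebraMap ℚ[X] K (yablonskiiVorobev (n + 1)) ^ 2
        - 4 * (algebraMap ℚ[X] K (yablonskiiVorobev (n + 1)) * D (D (algebraMap ℚ[X] K (yablonskiiVorobev (n + 1))))
          - D (algebraMap ℚ[X] K (yablonskiiVorobev (n + 1))) ^ 2)) / algebraMap ℚ[X] K (yablonskiiVorobev n) =
        algebraMap ℚ[X] K (yablonskiiVorobev (n + 2)) := by
      rw [div_eq_iff h.left_ne_zero, ← map_mul, hrec]
      simp only [hD, map_sub, map_mul, map_pow, map_ofNat]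
    rw [hq] at h'
    have h'' : IsPainlevePair D (algebraMap ℚ[X] K X) (((n + 1 : ℕ) : K) + 1) (algebraMap ℚ[X] K (yablonskiiVorobev (n + 1)))
        (algebraMap ℚ[X] K (yablonskiiVorobev (n + 1 + 1))) u' w' := by push_cast; exact h'
    have h4 := h.bilinear_four hz (hDn n)
    simp only [hD] at h4
    have h4' : yablonskiiVorobev (n + 1) *
        derivative (derivative (derivative (derivative (yablonskiiVorobev (n + 1)))))
      - 4 * (derivative (yablonskiiVorobev (n + 1)) *
        derivative (derivative (derivative (yablonskiiVorobev (n + 1)))))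
      + 3 * derivative (derivative (yablonskiiVorobev (n + 1))) ^ 2 =
        X * (yablonskiiVorobev (n + 1) * derivative (derivative (yablonskiiVorobev (n + 1)))
          - derivative (yablonskiiVorobev (n + 1)) ^ 2)
        + yablonskiiVorobev (n + 1) * derivative (yablonskiiVorobev (n + 1)) := by
      apply hι
      simpa only [map_add, map_sub, map_mul, map_pow, map_ofNat] using h4
    exact ⟨⟨u', w', h''⟩, h4', exact_div (n + 1) u' w' h'' h4'⟩

theorem yablonskiiVorobev_recurrence (n : ℕ) :
    yablonskiiVorobev (n + 2) * yablonskiiVorobev n =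
      X * yablonskiiVorobev (n + 1) ^ 2
        - 4 * (yablonskiiVorobev (n + 1) * derivative (derivative (yablonskiiVorobev (n + 1)))
          - derivative (yablonskiiVorobev (n + 1)) ^ 2) := by
  obtain ⟨K, _, _, _, _, D, hD⟩ := exists_field_derivation_extending_derivative
  exact (yablonskiiVorobev_pair hD n).2.2

theorem yablonskiiVorobev_ne_zero (n : ℕ) : yablonskiiVorobev n ≠ 0 := by
  obtain ⟨K, _, _, _, _, D, hD⟩ := exists_field_derivation_extending_derivative
  obtain ⟨u, w, h⟩ := (yablonskiiVorobev_pair hD n).1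
  exact fun h0 => h.left_ne_zero (by rw [h0, map_zero])

theorem yablonskiiVorobev_bilinear_four (n : ℕ) :
    yablonskiiVorobev n * derivative (derivative (derivative (derivative (yablonskiiVorobev n))))
      - 4 * (derivative (yablonskiiVorobev n) *
        derivative (derivative (derivative (yablonskiiVorobev n))))
      + 3 * derivative (derivative (yablonskiiVorobev n)) ^ 2 =
        X * (yablonskiiVorobev n * derivative (derivative (yablonskiiVorobev n))
          - derivative (yablonskiiVorobev n) ^ 2)
        + yablonskiiVorobev n * derivative (yablonskiiVorobev n) := by
  obtain ⟨K, _, _, _, _, D, hD⟩ := exists_field_derivation_extending_derivative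
  exact (yablonskiiVorobev_pair hD n).2.1

theorem yablonskiiVorobev_bilinear_three (n : ℕ) :
    derivative (derivative (derivative (yablonskiiVorobev n))) * yablonskiiVorobev (n + 1)
      - 3 * (derivative (derivative (yablonskiiVorobev n)) * derivative (yablonskiiVorobev (n + 1)))
      + 3 * (derivative (yablonskiiVorobev n) * derivative (derivative (yablonskiiVorobev (n + 1))))
      - yablonskiiVorobev n * derivative (derivative (derivative (yablonskiiVorobev (n + 1)))) =
        X * (derivative (yablonskiiVorobev n) * yablonskiiVorobev (n + 1)
          - yablonskiiVorobev n * derivative (yablonskiiVorobev (n + 1)))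
        + ((n : ℚ[X]) + 1) * (yablonskiiVorobev n * yablonskiiVorobev (n + 1)) := by
  obtain ⟨K, _, _, _, _, D, hD⟩ := exists_field_derivation_extending_derivative
  obtain ⟨u, w, h⟩ := (yablonskiiVorobev_pair hD n).1
  have h3 := h.bilinear_three (by rw [hD, derivative_X, map_one])
    (by rw [map_add, D.map_natCast, Derivation.map_one_eq_zero, add_zero])
  simp only [hD] at h3
  apply IsFractionRing.injective ℚ[X] K
  simpa only [map_add, map_sub, map_mul, map_ofNat, map_natCast, map_one] using h3

theorem yablonskiiVorobev_sigma_form (n : ℕ) {g g' g'' g''' : ℚ[X]} (h0 : yablonskiiVorobev n = g)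
    (h1 : derivative g = g') (h2 : derivative g' = g'') (h3 : derivative g'' = g''') :
    16 * (g * g'' - g' ^ 2) ^ 3 + 4 * (g ^ 2 * g''' - 3 * (g * g' * g'') + 2 * g' ^ 3) ^ 2
      - 2 * g ^ 3 * (g ^ 2 * g''' - 3 * (g * g' * g'') + 2 * g' ^ 3) =
    4 * X * g ^ 2 * (g * g'' - g' ^ 2) ^ 2 + 8 * g ^ 3 * g' * (g * g'' - g' ^ 2)
      - 2 * X * g ^ 5 * g' + ((n : ℚ[X]) * ((n : ℚ[X]) + 1)) * g ^ 6 := by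
  subst h0 h1 h2 h3
  -- A pair gives the equation for its right member `Q_{n+1}`, so index `0` is checked by hand.
  rcases n with _ | n
  · simp [yablonskiiVorobev]
  obtain ⟨K, _, _, _, _, D, hD⟩ := exists_field_derivation_extending_derivative
  obtain ⟨u, w, h⟩ := (yablonskiiVorobev_pair hD n).1
  have h3 := h.sigma_form (by rw [hD, derivative_X, map_one])
    (by rw [map_add, D.map_natCast, Derivation.map_one_eq_zero, add_zero])
  simp only [hD] at h3
  apply IsFractionRing.injective ℚ[X] K
  simpa only [map_add, map_sub, map_mul, map_pow, map_ofNat, map_natCast, map_one, Nat.cast_add,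
    Nat.cast_one] using h3

end YablonskiiVorobev

/-! ### Inverse power sums as a logarithmic derivative. -/

section PowerSums

/-- The generating series `-∑ (∑ 1 / z ^ (m + 1)) X ^ m` of inverse power sums of a multiset. -/
noncomputable def inversePowerSumSeries (s : Multiset ℂ) : PowerSeries ℂ :=
  PowerSeries.mk fun m => -(s.map fun z : ℂ => 1 / z ^ (m + 1)).sum

theorem derivative_prod_eq_prod_mul_inversePowerSumSeries (s : Multiset ℂ) (hs : (0 : ℂ) ∉ s) :
    PowerSeries.derivative ℂ (((s.map fun a => X - C a).prod : ℂ[X]) : PowerSeries ℂ) =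
      (((s.map fun a => X - C a).prod : ℂ[X]) : PowerSeries ℂ) * inversePowerSumSeries s := by
  induction s using Multiset.induction with
  | empty =>
    have : inversePowerSumSeries 0 = 0 := by ext; simp [inversePowerSumSeries]
    simp [this]
  | cons a s ih =>
    rw [Multiset.mem_cons, not_or] at hs
    have ha : a ≠ 0 := fun h => hs.1 h.symm
    have hcons : inversePowerSumSeries (a ::ₘ s) =
        PowerSeries.mk (fun m => -(1 / a ^ (m + 1))) + inversePowerSumSeries s := by
      ext m; simp [inversePowerSumSeries]; ring
    -- Geometric series for `1 / (X - a)`.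
    have hgeom : (PowerSeries.X - PowerSeries.C a) * PowerSeries.mk (fun m => -(1 / a ^ (m + 1)))
        = 1 := by
      ext m
      rcases m with _ | m
      · simp [sub_mul, ha]
      · rw [sub_mul, map_sub, PowerSeries.coeff_succ_X_mul, PowerSeries.coeff_C_mul,
          PowerSeries.coeff_mk, PowerSeries.coeff_mk, PowerSeries.coeff_one]
        simp
        field_simp
        ring
    rw [Multiset.map_cons, Multiset.prod_cons, hcons, Polynomial.coe_mul, Derivation.leibniz,
      ih hs.2]
    simp only [Polynomial.coe_sub, Polynomial.coe_X, Polynomial.coe_C, map_sub,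
      PowerSeries.derivative_X, PowerSeries.derivative_C, smul_eq_mul]
    linear_combination (-((s.map fun a => X - C a).prod : ℂ[X]) : PowerSeries ℂ) * hgeom

/-- After splitting off the root `0`, the logarithmic derivative of a complex polynomial is the
generating series of the inverse power sums of its nonzero roots. -/
theorem exists_eq_X_pow_mul_and_derivative_eq {p : ℂ[X]} (hp : p ≠ 0) :
    ∃ q : ℂ[X], p = X ^ rootMultiplicity 0 p * q ∧ q ≠ 0 ∧
      PowerSeries.derivative ℂ (q : PowerSeries ℂ) =
        q * inversePowerSumSeries (p.roots.filter fun z : ℂ => z ≠ 0) := by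
  obtain ⟨s, hs⟩ : ∃ s, s = p.roots.filter fun z : ℂ => z ≠ 0 := ⟨_, rfl⟩
  have hroots : p.roots = Multiset.replicate (rootMultiplicity 0 p) 0 + s := by
    rw [hs, ← count_roots, ← Multiset.filter_eq', Multiset.filter_add_not]
  have hprod := (IsAlgClosed.splits p).eq_prod_roots
  rw [hroots, Multiset.map_add, Multiset.prod_add, Multiset.map_replicate, Multiset.prod_replicate,
    C_0, sub_zero] at hprod
  have hpq : p = X ^ rootMultiplicity 0 p * (C p.leadingCoeff * (s.map fun a => X - C a).prod) := by
    conv_lhs => rw [hprod]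
    ring
  refine ⟨C p.leadingCoeff * (s.map fun a => X - C a).prod, hpq, fun h0 => hp ?_, ?_⟩
  · rw [hpq, h0, mul_zero]
  · rw [← hs, Polynomial.coe_mul, Derivation.leibniz,
      derivative_prod_eq_prod_mul_inversePowerSumSeries s (by simp [hs]), Polynomial.coe_C,
      PowerSeries.derivative_C]
    simp only [smul_eq_mul]
    ring

theorem inversePowerSumSeries_coeff (n m : ℕ) :
    PowerSeries.coeff m (inversePowerSumSeries
      (((yablonskiiVorobev n).map (algebraMap ℚ ℂ)).roots.filter fun z : ℂ => z ≠ 0)) =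
      -inversePowerSum n (m + 1) := by
  rw [inversePowerSumSeries, PowerSeries.coeff_mk, inversePowerSum, aroots]

end PowerSums

/-! ### Cube-root-of-unity symmetry and the root at the origin. -/

section Symmetry

theorem comp_C_mul_X_derivative (p : ℂ[X]) (ζ c : ℂ) (h : p.comp (C ζ * X) = C c * p) :
    C ζ * (derivative p).comp (C ζ * X) = C c * derivative p := by
  have := congrArg derivative h
  simpa [derivative_comp] using this

/-- The rotational symmetry of the Yablonskii-Vorob'ev polynomials. -/
theorem yablonskiiVorobev_comp {ζ : ℂ} (hζ : ζ ^ 3 = 1) (n : ℕ) :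
    ((yablonskiiVorobev n).map (algebraMap ℚ ℂ)).comp (C ζ * X) =
      C (if n % 3 = 1 then ζ else 1) * (yablonskiiVorobev n).map (algebraMap ℚ ℂ) := by
  have hζ0 : ζ ≠ 0 := by rintro rfl; norm_num at hζ
  have key : ∀ n : ℕ, ((yablonskiiVorobev n).map (algebraMap ℚ ℂ)).comp (C ζ * X) =
      C (if n % 3 = 1 then ζ else 1) * (yablonskiiVorobev n).map (algebraMap ℚ ℂ) ∧
      ((yablonskiiVorobev (n + 1)).map (algebraMap ℚ ℂ)).comp (C ζ * X) =
      C (if (n + 1) % 3 = 1 then ζ else 1) * (yablonskiiVorobev (n + 1)).map (algebraMap ℚ ℂ) := by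
    intro n
    induction n with
    | zero => simp [yablonskiiVorobev]
    | succ n ih =>
      refine ⟨ih.2, ?_⟩
      obtain ⟨hf, hg⟩ := ih
      have hrec := congrArg (Polynomial.map (algebraMap ℚ ℂ)) (yablonskiiVorobev_recurrence n)
      have hf0 : (yablonskiiVorobev n).map (algebraMap ℚ ℂ) ≠ 0 :=
        (Polynomial.map_ne_zero_iff (algebraMap ℚ ℂ).injective).2 (yablonskiiVorobev_ne_zero n)
      simp only [Polynomial.map_sub, Polynomial.map_mul, Polynomial.map_pow,
        ← derivative_map, map_X, Polynomial.map_ofNat] at hrec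
      change ((yablonskiiVorobev (n + 2)).map (algebraMap ℚ ℂ)).comp (C ζ * X) = _
      -- Both sides of the recurrence scale alike: `X` contributes `ζ`, and two derivatives
      -- contribute `ζ⁻² = ζ`.
      have hc : (if (n + 1 + 1) % 3 = 1 then ζ else 1) * (if n % 3 = 1 then ζ else 1) =
          ζ * (if (n + 1) % 3 = 1 then ζ else 1) ^ 2 := by
        have : n % 3 = 0 ∨ n % 3 = 1 ∨ n % 3 = 2 := by omega
        rcases this with h | h | h <;> simp [Nat.add_mod, h]
        linear_combination -hζ
      generalize (yablonskiiVorobev n).map (algebraMap ℚ ℂ) = f at *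
      generalize (yablonskiiVorobev (n + 1)).map (algebraMap ℚ ℂ) = g at *
      generalize (yablonskiiVorobev (n + 2)).map (algebraMap ℚ ℂ) = h at *
      generalize (if (n + 1 + 1) % 3 = 1 then ζ else 1) = c₂ at *
      generalize (if (n + 1) % 3 = 1 then ζ else 1) = c₁ at *
      generalize (if n % 3 = 1 then ζ else 1) = c₀ at *
      have hc₀ : c₀ ≠ 0 := by
        rintro rfl
        rw [C_0, zero_mul, comp_eq_zero_iff] at hf
        rcases hf with h | ⟨-, h⟩
        · exact hf0 h
        · have := congrArg (fun p : ℂ[X] => p.coeff 1) h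
          simp [hζ0] at this
      have hg1 := comp_C_mul_X_derivative g ζ c₁ hg
      have hg2 : C ζ ^ 2 * (derivative (derivative g)).comp (C ζ * X) =
          C c₁ * derivative (derivative g) := by
        have h1 : (derivative g).comp (C ζ * X) = C (c₁ / ζ) * derivative g := by
          apply mul_left_cancel₀ (C_ne_zero.2 hζ0)
          rw [hg1, ← mul_assoc, ← C_mul, mul_div_cancel₀ _ hζ0]
        have h2 := comp_C_mul_X_derivative _ ζ _ h1
        rw [pow_two, mul_assoc, h2, ← mul_assoc, ← C_mul, mul_div_cancel₀ _ hζ0]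
      have hcomp := congrArg (fun p : ℂ[X] => p.comp (C ζ * X)) hrec
      simp only [mul_comp, sub_comp, pow_comp, X_comp, ofNat_comp, hf, hg] at hcomp
      have hC : (C c₂ * C c₀ : ℂ[X]) = C ζ * C c₁ ^ 2 := by rw [← C_mul, hc, C_mul, C_pow]
      have hCζ : (C ζ ^ 3 : ℂ[X]) = 1 := by rw [← C_pow, hζ, C_1]
      apply mul_right_cancel₀ (mul_ne_zero (C_ne_zero.2 hc₀) hf0)
      generalize (derivative (derivative g)).comp (C ζ * X) = G2 at *
      generalize (derivative g).comp (C ζ * X) = G1 at *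
      generalize h.comp (C ζ * X) = H at *
      generalize derivative (derivative g) = g2 at *
      generalize derivative g = g1 at *
      linear_combination hcomp - h * f * hC - C ζ * C c₁ ^ 2 * hrec
        - 4 * C c₁ * g * C ζ * hg2 + 4 * C ζ * (C ζ * G1 + C c₁ * g1) * hg1
        + 4 * (C c₁ * g * G2 - G1 ^ 2) * hCζ
  exact (key n).1

theorem inversePowerSum_eq_zero_of_not_dvd {m : ℕ} (hm : ¬ 3 ∣ m) (n : ℕ) :
    inversePowerSum n m = 0 := by
  obtain ⟨ζ, hζ⟩ : ∃ ζ : ℂ, IsPrimitiveRoot ζ 3 :=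
    ⟨_, Complex.isPrimitiveRoot_exp 3 (by norm_num)⟩
  have hζ0 : ζ ≠ 0 := hζ.ne_zero (by norm_num)
  have hmap := map_roots_comp_C_mul_X_add_C ((yablonskiiVorobev n).map (algebraMap ℚ ℂ)) ζ 0
    hζ0.isUnit
  have hc : (if n % 3 = 1 then ζ else 1) ≠ 0 := by split_ifs <;> simp [hζ0]
  simp only [C_0, add_zero] at hmap
  rw [yablonskiiVorobev_comp hζ.pow_eq_one, roots_C_mul _ hc] at hmap
  have h1 : inversePowerSum n m = (1 / ζ ^ m) * inversePowerSum n m := by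
    conv_lhs => rw [inversePowerSum, aroots, ← hmap]
    rw [inversePowerSum, aroots, Multiset.filter_map, Multiset.map_map, ← Multiset.sum_map_mul_left]
    congr 1
    rw [Multiset.filter_congr (q := fun z : ℂ => z ≠ 0) (by simp [hζ0])]
    refine Multiset.map_congr rfl fun x _ => ?_
    simp [mul_pow, mul_comm]
  have h2 : ζ ^ m ≠ 1 := fun h => hm (hζ.dvd_of_pow_eq_one m h)
  have h3 : ζ ^ m ≠ 0 := pow_ne_zero m hζ0
  have h4 : (ζ ^ m - 1) * inversePowerSum n m = 0 := by
    field_simp at h1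
    linear_combination h1
  exact (mul_eq_zero.1 h4).resolve_left (sub_ne_zero.2 h2)

theorem map_bilinear_four (n : ℕ) {g g' g'' g''' g'''' : ℂ[X]}
    (h0 : (yablonskiiVorobev n).map (algebraMap ℚ ℂ) = g) (h1 : derivative g = g')
    (h2 : derivative g' = g'') (h3 : derivative g'' = g''') (h4 : derivative g''' = g'''') :
    g * g'''' - 4 * (g' * g''') + 3 * g'' ^ 2 = X * (g * g'' - g' ^ 2) + g * g' := by
  subst h0 h1 h2 h3 h4
  have := congrArg (Polynomial.map (algebraMap ℚ ℂ)) (yablonskiiVorobev_bilinear_four n)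
  simpa only [Polynomial.map_add, Polynomial.map_sub, Polynomial.map_mul, Polynomial.map_pow,
    ← derivative_map, map_X, Polynomial.map_ofNat] using this

/-- A root at `0` is simple, so comparing linear coefficients in the symmetry forces the factor `ζ`;
if `0` is not a root, comparing constant terms forces the factor `1`. -/
theorem rootMultiplicity_zero_yablonskiiVorobev (n : ℕ) :
    rootMultiplicity 0 ((yablonskiiVorobev n).map (algebraMap ℚ ℂ)) =
      if n % 3 = 1 then 1 else 0 := by
  obtain ⟨ζ, hζ⟩ : ∃ ζ : ℂ, IsPrimitiveRoot ζ 3 :=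
    ⟨_, Complex.isPrimitiveRoot_exp 3 (by norm_num)⟩
  have hζ1 : ζ ≠ 1 := hζ.ne_one (by norm_num)
  have hsym := yablonskiiVorobev_comp hζ.pow_eq_one n
  have hbil := map_bilinear_four n rfl rfl rfl rfl rfl
  have hp : (yablonskiiVorobev n).map (algebraMap ℚ ℂ) ≠ 0 :=
    (Polynomial.map_ne_zero_iff (algebraMap ℚ ℂ).injective).2 (yablonskiiVorobev_ne_zero n)
  generalize (yablonskiiVorobev n).map (algebraMap ℚ ℂ) = p at *
  have hsym' := comp_C_mul_X_derivative _ _ _ hsym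
  have e0 := congrArg (eval 0) hsym
  have e1 := congrArg (eval 0) hsym'
  simp only [eval_comp, eval_mul, eval_C, eval_X, mul_zero] at e0 e1
  by_cases h0 : p.eval 0 = 0
  · have h1 := eval_derivative_ne_zero_of_bilinear_four hp hbil h0
    have hc := mul_right_cancel₀ h1 e1
    have hn : n % 3 = 1 := by
      by_contra hn
      rw [if_neg hn] at hc
      exact hζ1 hc
    rw [if_pos hn]
    apply le_antisymm
    · by_contra! hlt
      exact h1 ((one_lt_rootMultiplicity_iff_isRoot hp).1 hlt).2
    · exact (rootMultiplicity_pos hp).2 h0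
  · have hn : ¬ n % 3 = 1 := by
      intro hn
      rw [if_pos hn] at e0
      exact hζ1 (mul_right_cancel₀ h0 (by rw [← e0, one_mul]))
    rw [if_neg hn]
    exact rootMultiplicity_eq_zero h0

end Symmetry

/-! ### Differential equations for the generating series and its free coefficients. -/

section DifferentialEquation

theorem map_bilinear_three (n : ℕ) {f f' f'' f''' g g' g'' g''' : ℂ[X]}
    (hf0 : (yablonskiiVorobev n).map (algebraMap ℚ ℂ) = f) (hf1 : derivative f = f')
    (hf2 : derivative f' = f'') (hf3 : derivative f'' = f''')
    (hg0 : (yablonskiiVorobev (n + 1)).map (algebraMap ℚ ℂ) = g) (hg1 : derivative g = g')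
    (hg2 : derivative g' = g'') (hg3 : derivative g'' = g''') :
    f''' * g - 3 * (f'' * g') + 3 * (f' * g'') - f * g''' =
      X * (f' * g - f * g') + ((n : ℂ[X]) + 1) * (f * g) := by
  subst hf0 hf1 hf2 hf3 hg0 hg1 hg2 hg3
  have := congrArg (Polynomial.map (algebraMap ℚ ℂ)) (yablonskiiVorobev_bilinear_three n)
  simpa only [Polynomial.map_add, Polynomial.map_sub, Polynomial.map_mul, Polynomial.map_pow,
    ← derivative_map, map_X, Polynomial.map_ofNat, Polynomial.map_natCast, Polynomial.map_one]
    using this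

theorem map_sigma_form (n : ℕ) {g g' g'' g''' : ℂ[X]}
    (h0 : (yablonskiiVorobev n).map (algebraMap ℚ ℂ) = g) (h1 : derivative g = g')
    (h2 : derivative g' = g'') (h3 : derivative g'' = g''') :
    16 * (g * g'' - g' ^ 2) ^ 3 + 4 * (g ^ 2 * g''' - 3 * (g * g' * g'') + 2 * g' ^ 3) ^ 2
      - 2 * g ^ 3 * (g ^ 2 * g''' - 3 * (g * g' * g'') + 2 * g' ^ 3) =
    4 * X * g ^ 2 * (g * g'' - g' ^ 2) ^ 2 + 8 * g ^ 3 * g' * (g * g'' - g' ^ 2)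
      - 2 * X * g ^ 5 * g' + ((n : ℂ[X]) * ((n : ℂ[X]) + 1)) * g ^ 6 := by
  subst h0 h1 h2 h3
  have := congrArg (Polynomial.map (algebraMap ℚ ℂ)) (yablonskiiVorobev_sigma_form n rfl rfl rfl rfl)
  simpa only [Polynomial.map_add, Polynomial.map_sub, Polynomial.map_mul, Polynomial.map_pow,
    ← derivative_map, map_X, Polynomial.map_ofNat, Polynomial.map_natCast, Polynomial.map_one]
    using this

/-- The generating series `-∑ S_{m+1}(n) X ^ m`. -/
noncomputable def powerSumSeries (n : ℕ) : PowerSeries ℂ :=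
  PowerSeries.mk fun m => -inversePowerSum n (m + 1)

theorem coeff_powerSumSeries_eq_zero {m : ℕ} (hm : ¬ 3 ∣ m + 1) (n : ℕ) :
    PowerSeries.coeff m (powerSumSeries n) = 0 := by
  rw [powerSumSeries, PowerSeries.coeff_mk, inversePowerSum_eq_zero_of_not_dvd hm, neg_zero]

theorem exists_log_derivative (n : ℕ) :
    ∃ q : ℂ[X], (yablonskiiVorobev n).map (algebraMap ℚ ℂ) = X ^ (if n % 3 = 1 then 1 else 0) * q ∧
      (q : PowerSeries ℂ) ≠ 0 ∧
      PowerSeries.derivative ℂ (q : PowerSeries ℂ) = q * powerSumSeries n := by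
  obtain ⟨q, h1, h2, h3⟩ := exists_eq_X_pow_mul_and_derivative_eq
    ((Polynomial.map_ne_zero_iff (algebraMap ℚ ℂ).injective).2 (yablonskiiVorobev_ne_zero n))
  refine ⟨q, ?_, by simpa using h2, ?_⟩
  · rwa [rootMultiplicity_zero_yablonskiiVorobev] at h1
  · rw [h3]
    refine congrArg _ (PowerSeries.ext fun m => ?_)
    rw [inversePowerSumSeries_coeff, powerSumSeries, PowerSeries.coeff_mk]

local notation "∂" => PowerSeries.derivative ℂ

theorem exists_log_derivative_of_ne {n : ℕ} (hn : n % 3 ≠ 1) :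
    ∃ q : ℂ[X], (yablonskiiVorobev n).map (algebraMap ℚ ℂ) = q ∧ (q : PowerSeries ℂ) ≠ 0 ∧
      ∂ (q : PowerSeries ℂ) = q * powerSumSeries n := by
  obtain ⟨q, h1, h2⟩ := exists_log_derivative n
  rw [if_neg hn, pow_zero, one_mul] at h1
  exact ⟨q, h1, h2⟩

theorem powerSumSeries_ode_of_ne {n : ℕ} (hn : n % 3 ≠ 1) :
    ∂ (∂ (∂ (powerSumSeries n))) + 6 * ∂ (powerSumSeries n) ^ 2 =
      ∂ (PowerSeries.X * powerSumSeries n) := by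
  obtain ⟨q, h0, hq, hD⟩ := exists_log_derivative_of_ne hn
  have h := congrArg (coeToPowerSeries.ringHom (R := ℂ)) (map_bilinear_four n h0 rfl rfl rfl rfl)
  simp only [map_add, map_sub, map_mul, map_pow, map_ofNat,
    coeToPowerSeries.ringHom_apply, ← PowerSeries.derivative_coe, Polynomial.coe_X] at h
  rw [deriv_four_of_log_deriv hD, deriv_three_of_log_deriv hD, deriv_two_of_log_deriv hD, hD] at h
  apply mul_left_cancel₀ (pow_ne_zero 2 hq)
  rw [Derivation.leibniz, PowerSeries.derivative_X]
  simp only [smul_eq_mul]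
  linear_combination h

theorem powerSumSeries_sigma_of_ne {n : ℕ} (hn : n % 3 ≠ 1) :
    16 * ∂ (powerSumSeries n) ^ 3 + 4 * ∂ (∂ (powerSumSeries n)) ^ 2
      - 2 * ∂ (∂ (powerSumSeries n)) =
    4 * PowerSeries.X * ∂ (powerSumSeries n) ^ 2 + 8 * powerSumSeries n * ∂ (powerSumSeries n)
      - 2 * PowerSeries.X * powerSumSeries n + (n : PowerSeries ℂ) * ((n : PowerSeries ℂ) + 1) := by
  obtain ⟨q, h0, hq, hD⟩ := exists_log_derivative_of_ne hn
  have h := congrArg (coeToPowerSeries.ringHom (R := ℂ)) (map_sigma_form n h0 rfl rfl rfl)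
  simp only [map_add, map_sub, map_mul, map_pow, map_ofNat, map_natCast, map_one,
    coeToPowerSeries.ringHom_apply, ← PowerSeries.derivative_coe, Polynomial.coe_X] at h
  rw [deriv_three_of_log_deriv hD, deriv_two_of_log_deriv hD, hD] at h
  apply mul_left_cancel₀ (pow_ne_zero 6 hq)
  linear_combination h

theorem exists_log_derivative_of_eq {n : ℕ} (hn : n % 3 = 1) :
    ∃ q : ℂ[X], (yablonskiiVorobev n).map (algebraMap ℚ ℂ) = X * q ∧ (q : PowerSeries ℂ) ≠ 0 ∧
      ∂ (q : PowerSeries ℂ) = q * powerSumSeries n := by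
  obtain ⟨q, h1, h2⟩ := exists_log_derivative n
  rw [if_pos hn, pow_one] at h1
  exact ⟨q, h1, h2⟩

theorem iterate_derivative_X_mul (q : ℂ[X]) :
    derivative (X * q) = q + X * derivative q ∧
    derivative (q + X * derivative q) = 2 * derivative q + X * derivative (derivative q) ∧
    derivative (2 * derivative q + X * derivative (derivative q)) =
      3 * derivative (derivative q) + X * derivative (derivative (derivative q)) ∧
    derivative (3 * derivative (derivative q) + X * derivative (derivative (derivative q))) =
      4 * derivative (derivative (derivative q))
        + X * derivative (derivative (derivative (derivative q))) := by
  refine ⟨?_, ?_, ?_, ?_⟩ <;>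
    simp only [derivative_mul, derivative_add, derivative_X, derivative_ofNat] <;> ring

/-- Here the logarithmic derivative is `1/X + s`; the pole produces the term `-12 s'` after
multiplication by `X²`, and the pure pole terms cancel. -/
theorem powerSumSeries_ode_of_eq {n : ℕ} (hn : n % 3 = 1) :
    PowerSeries.X ^ 2 * ∂ (∂ (∂ (powerSumSeries n))) - 12 * ∂ (powerSumSeries n)
      + 6 * (PowerSeries.X ^ 2 * ∂ (powerSumSeries n) ^ 2) =
      PowerSeries.X ^ 2 * ∂ (PowerSeries.X * powerSumSeries n) := by
  obtain ⟨q, h0, hq, hD⟩ := exists_log_derivative_of_eq hn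
  obtain ⟨e1, e2, e3, e4⟩ := iterate_derivative_X_mul q
  have h := congrArg (coeToPowerSeries.ringHom (R := ℂ)) (map_bilinear_four n h0 e1 e2 e3 e4)
  simp only [map_add, map_sub, map_mul, map_pow, map_ofNat,
    coeToPowerSeries.ringHom_apply, ← PowerSeries.derivative_coe, Polynomial.coe_X] at h
  rw [deriv_four_of_log_deriv hD, deriv_three_of_log_deriv hD, deriv_two_of_log_deriv hD, hD] at h
  apply mul_left_cancel₀ (pow_ne_zero 2 hq)
  rw [Derivation.leibniz, PowerSeries.derivative_X]
  simp only [smul_eq_mul]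
  linear_combination h

theorem powerSumSeries_sigma_of_eq {n : ℕ} (hn : n % 3 = 1) :
    16 * (PowerSeries.X ^ 2 * ∂ (powerSumSeries n) - 1) ^ 3
      + 4 * (2 + PowerSeries.X ^ 3 * ∂ (∂ (powerSumSeries n))) ^ 2
      - 2 * PowerSeries.X ^ 3 * (2 + PowerSeries.X ^ 3 * ∂ (∂ (powerSumSeries n))) =
    4 * PowerSeries.X ^ 3 * (PowerSeries.X ^ 2 * ∂ (powerSumSeries n) - 1) ^ 2
      + 8 * PowerSeries.X ^ 3 * (1 + PowerSeries.X * powerSumSeries n)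
        * (PowerSeries.X ^ 2 * ∂ (powerSumSeries n) - 1)
      - 2 * PowerSeries.X ^ 6 * (1 + PowerSeries.X * powerSumSeries n)
      + (n : PowerSeries ℂ) * ((n : PowerSeries ℂ) + 1) * PowerSeries.X ^ 6 := by
  obtain ⟨q, h0, hq, hD⟩ := exists_log_derivative_of_eq hn
  obtain ⟨e1, e2, e3, -⟩ := iterate_derivative_X_mul q
  have h := congrArg (coeToPowerSeries.ringHom (R := ℂ)) (map_sigma_form n h0 e1 e2 e3)
  simp only [map_add, map_sub, map_mul, map_pow, map_ofNat, map_natCast, map_one,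
    coeToPowerSeries.ringHom_apply, ← PowerSeries.derivative_coe, Polynomial.coe_X] at h
  rw [deriv_three_of_log_deriv hD, deriv_two_of_log_deriv hD, hD] at h
  apply mul_left_cancel₀ (pow_ne_zero 6 hq)
  linear_combination h

theorem coeff_six_mul_derivative_sq (f : PowerSeries ℂ) (k : ℕ) :
    PowerSeries.coeff k (6 * ∂ f ^ 2) = 6 * ∑ x ∈ Finset.HasAntidiagonal.antidiagonal k,
      (PowerSeries.coeff (x.1 + 1) f * (x.1 + 1)) * (PowerSeries.coeff (x.2 + 1) f * (x.2 + 1)) := by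
  rw [show (6 : PowerSeries ℂ) = PowerSeries.C 6 from (map_ofNat _ 6).symm,
    PowerSeries.coeff_C_mul, pow_two, PowerSeries.coeff_mul]
  simp only [PowerSeries.coeff_derivative]

theorem coeff_derivative_X_mul (f : PowerSeries ℂ) (k : ℕ) :
    PowerSeries.coeff k (∂ (PowerSeries.X * f)) = (k + 1) * PowerSeries.coeff k f := by
  rw [PowerSeries.coeff_derivative, PowerSeries.coeff_succ_X_mul, mul_comm]

theorem powerSumSeries_ode_of_ne_coeff {n : ℕ} (hn : n % 3 ≠ 1) (k : ℕ) :
    ((k : ℂ) + 1) * (k + 2) * (k + 3) * PowerSeries.coeff (k + 3) (powerSumSeries n) =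
      (k + 1) * PowerSeries.coeff k (powerSumSeries n)
      - 6 * ∑ x ∈ Finset.HasAntidiagonal.antidiagonal k,
        (PowerSeries.coeff (x.1 + 1) (powerSumSeries n) * (x.1 + 1)) *
          (PowerSeries.coeff (x.2 + 1) (powerSumSeries n) * (x.2 + 1)) := by
  have h := congrArg (PowerSeries.coeff k) (powerSumSeries_ode_of_ne hn)
  rw [map_add, coeff_six_mul_derivative_sq, coeff_derivative_X_mul] at h
  simp only [PowerSeries.coeff_derivative] at h
  push_cast at h
  linear_combination h

/-- The term `-12 s'` turns `(k+1)(k+2)` into `(k+5)(k-2)`, so the recursion says nothing about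
coefficient `5`. -/
theorem powerSumSeries_ode_of_eq_coeff {n : ℕ} (hn : n % 3 = 1) (k : ℕ) :
    ((k : ℂ) + 5) * (k - 2) * (k + 3) * PowerSeries.coeff (k + 3) (powerSumSeries n) =
      (k + 1) * PowerSeries.coeff k (powerSumSeries n)
      - 6 * ∑ x ∈ Finset.HasAntidiagonal.antidiagonal k,
        (PowerSeries.coeff (x.1 + 1) (powerSumSeries n) * (x.1 + 1)) *
          (PowerSeries.coeff (x.2 + 1) (powerSumSeries n) * (x.2 + 1)) := by
  have h := congrArg (PowerSeries.coeff (k + 2)) (powerSumSeries_ode_of_eq hn)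
  rw [show ∀ f : PowerSeries ℂ, 6 * (PowerSeries.X ^ 2 * f) = PowerSeries.X ^ 2 * (6 * f) by
    intro f; ring, show (12 : PowerSeries ℂ) = PowerSeries.C 12 from (map_ofNat _ 12).symm, map_add,
    map_sub, PowerSeries.coeff_C_mul, PowerSeries.coeff_X_pow_mul, PowerSeries.coeff_X_pow_mul,
    PowerSeries.coeff_X_pow_mul, coeff_six_mul_derivative_sq, coeff_derivative_X_mul] at h
  simp only [PowerSeries.coeff_derivative] at h
  push_cast at h
  linear_combination h

theorem powerSumSeries_coeff_two_of_eq {n : ℕ} (hn : n % 3 = 1) :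
    PowerSeries.coeff 2 (powerSumSeries n) = 0 := by
  have h := congrArg (PowerSeries.coeff 1) (powerSumSeries_ode_of_eq hn)
  rw [← map_ofNat PowerSeries.C 6, ← map_ofNat PowerSeries.C 12] at h
  simp only [map_add, map_sub, PowerSeries.coeff_C_mul, PowerSeries.coeff_X_pow_mul'] at h
  simp [PowerSeries.coeff_derivative] at h
  exact h

theorem powerSumSeries_coeff_five_of_eq {n : ℕ} (hn : n % 3 = 1) :
    560 * PowerSeries.coeff 5 (powerSumSeries n) = (n : ℂ) * (n + 1) - 2 := by
  have h := powerSumSeries_sigma_of_eq hn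
  obtain ⟨V, hV⟩ : PowerSeries.X ^ 5 ∣ powerSumSeries n := by
    rw [PowerSeries.X_pow_dvd_iff]
    intro m hm
    interval_cases m
    · exact coeff_powerSumSeries_eq_zero (by norm_num) n
    · exact coeff_powerSumSeries_eq_zero (by norm_num) n
    · exact powerSumSeries_coeff_two_of_eq hn
    · exact coeff_powerSumSeries_eq_zero (by norm_num) n
    · exact coeff_powerSumSeries_eq_zero (by norm_num) n
  have h5 : PowerSeries.coeff 5 (powerSumSeries n) = PowerSeries.constantCoeff V := by
    rw [hV, PowerSeries.coeff_X_pow_mul', if_pos le_rfl]; simp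
  rw [h5]
  have d1 : ∂ (powerSumSeries n) = PowerSeries.X ^ 4 * (5 * V + PowerSeries.X * ∂ V) := by
    rw [hV, Derivation.leibniz, Derivation.leibniz_pow, PowerSeries.derivative_X]
    simp only [smul_eq_mul, nsmul_eq_mul]; push_cast; ring
  have d2 : ∂ (∂ (powerSumSeries n)) = PowerSeries.X ^ 3 *
      (20 * V + PowerSeries.X * (10 * ∂ V + PowerSeries.X * ∂ (∂ V))) := by
    have h5' : ∂ (5 : PowerSeries ℂ) = 0 := by
      rw [← map_ofNat PowerSeries.C 5, PowerSeries.derivative_C]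
    rw [d1, Derivation.leibniz, Derivation.leibniz_pow, map_add, Derivation.leibniz,
      Derivation.leibniz, PowerSeries.derivative_X, h5']
    simp only [smul_eq_mul, nsmul_eq_mul]; push_cast; ring
  rw [d2, d1, hV] at h
  obtain ⟨A, hA⟩ : ∃ A, A = 5 * V + PowerSeries.X * ∂ V := ⟨_, rfl⟩
  obtain ⟨B', hB'⟩ : ∃ B', B' = 10 * ∂ V + PowerSeries.X * ∂ (∂ V) := ⟨_, rfl⟩
  obtain ⟨B, hB⟩ : ∃ B, B = 20 * V + PowerSeries.X * B' := ⟨_, rfl⟩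
  rw [← hB', ← hB, ← hA] at h
  -- With `s = X^5 V` everything below `X^6` cancels. At `X^6` the linear terms give `48·5 + 16·20 =
  -- 560`.
  have hW : PowerSeries.X ^ 6 * (560 * V + PowerSeries.X * (48 * ∂ V + 16 * B'
      + PowerSeries.X ^ 2 * (8 * V - 2 * B)
      + PowerSeries.X ^ 5 * (4 * B ^ 2 - 48 * A ^ 2 + 2 * V)
      - PowerSeries.X ^ 8 * (4 * A ^ 2 + 8 * V * A) + 16 * PowerSeries.X ^ 11 * A ^ 3) + 2
      - (n : PowerSeries ℂ) * ((n : PowerSeries ℂ) + 1)) = PowerSeries.X ^ 6 * 0 := by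
    linear_combination h - 48 * PowerSeries.X ^ 6 * hA - 16 * PowerSeries.X ^ 6 * hB
  have h7 := congrArg PowerSeries.constantCoeff (mul_left_cancel₀
    (pow_ne_zero 6 PowerSeries.X_ne_zero) hW)
  simp only [map_add, map_sub, map_mul, map_ofNat, map_natCast, map_one, map_zero,
    PowerSeries.constantCoeff_X, zero_mul] at h7
  linear_combination h7

/-- The sigma form at `X = 0` is a quadratic equation for this coefficient, and it factors. -/
theorem powerSumSeries_coeff_two_eq_or {n : ℕ} (hn : n % 3 ≠ 1) :
    4 * PowerSeries.coeff 2 (powerSumSeries n) = (n : ℂ) + 1 ∨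
      4 * PowerSeries.coeff 2 (powerSumSeries n) = -(n : ℂ) := by
  have h := congrArg (PowerSeries.coeff 0) (powerSumSeries_sigma_of_ne hn)
  have h0 := coeff_powerSumSeries_eq_zero (m := 0) (by norm_num) n
  have h1 := coeff_powerSumSeries_eq_zero (m := 1) (by norm_num) n
  have d0 : PowerSeries.constantCoeff (∂ (powerSumSeries n)) = 0 := by
    rw [← PowerSeries.coeff_zero_eq_constantCoeff_apply, PowerSeries.coeff_derivative]
    simp [h1]
  have d1 : PowerSeries.constantCoeff (∂ (∂ (powerSumSeries n))) =
      2 * PowerSeries.coeff 2 (powerSumSeries n) := by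
    rw [← PowerSeries.coeff_zero_eq_constantCoeff_apply, PowerSeries.coeff_derivative,
      PowerSeries.coeff_derivative]
    push_cast; ring
  simp only [PowerSeries.coeff_zero_eq_constantCoeff_apply, map_add, map_sub, map_mul, map_pow,
    map_ofNat, map_natCast, map_one, PowerSeries.constantCoeff_X, d0, d1] at h
  have : (4 * PowerSeries.coeff 2 (powerSumSeries n) - ((n : ℂ) + 1)) *
      (4 * PowerSeries.coeff 2 (powerSumSeries n) + n) = 0 := by linear_combination h
  rcases mul_eq_zero.1 this with h | h
  · left; linear_combination h
  · right; linear_combination h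

/-- Constant term of the cubic bilinear relation divided by `f g`. Neither `Q_n` nor `Q_{n+1}`
vanishes at `0` in this class. -/
theorem powerSumSeries_coeff_two_sub {n : ℕ} (hn : n % 3 = 2) :
    2 * (PowerSeries.coeff 2 (powerSumSeries n) - PowerSeries.coeff 2 (powerSumSeries (n + 1))) =
      (n : ℂ) + 1 := by
  obtain ⟨f, hf0, hf, hDf⟩ := exists_log_derivative_of_ne (n := n) (by omega)
  obtain ⟨g, hg0, hg, hDg⟩ := exists_log_derivative_of_ne (n := n + 1) (by omega)
  have h := congrArg (coeToPowerSeries.ringHom (R := ℂ))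
    (map_bilinear_three n hf0 rfl rfl rfl hg0 rfl rfl rfl)
  simp only [map_add, map_sub, map_mul, map_ofNat, map_natCast, map_one,
    coeToPowerSeries.ringHom_apply, ← PowerSeries.derivative_coe, Polynomial.coe_X] at h
  rw [deriv_three_of_log_deriv hDf, deriv_two_of_log_deriv hDf, hDf, deriv_three_of_log_deriv hDg,
    deriv_two_of_log_deriv hDg, hDg] at h
  have d : ∀ m, PowerSeries.constantCoeff (powerSumSeries m) = 0 ∧
      PowerSeries.constantCoeff (∂ (powerSumSeries m)) = 0 ∧
      PowerSeries.constantCoeff (∂ (∂ (powerSumSeries m))) =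
        2 * PowerSeries.coeff 2 (powerSumSeries m) := fun m => by
    refine ⟨?_, ?_, ?_⟩
    · rw [← PowerSeries.coeff_zero_eq_constantCoeff_apply]
      exact coeff_powerSumSeries_eq_zero (by norm_num) m
    · rw [← PowerSeries.coeff_zero_eq_constantCoeff_apply, PowerSeries.coeff_derivative,
        coeff_powerSumSeries_eq_zero (by norm_num) m, zero_mul]
    · rw [← PowerSeries.coeff_zero_eq_constantCoeff_apply, PowerSeries.coeff_derivative,
        PowerSeries.coeff_derivative]
      push_cast; ring
  have h' := mul_left_cancel₀ (mul_ne_zero hf hg) (a := (f : PowerSeries ℂ) * g)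
    (b := powerSumSeries n ^ 3 + 3 * (powerSumSeries n * ∂ (powerSumSeries n))
        + ∂ (∂ (powerSumSeries n))
      - 3 * ((powerSumSeries n ^ 2 + ∂ (powerSumSeries n)) * powerSumSeries (n + 1))
      + 3 * (powerSumSeries n * (powerSumSeries (n + 1) ^ 2 + ∂ (powerSumSeries (n + 1))))
      - (powerSumSeries (n + 1) ^ 3 + 3 * (powerSumSeries (n + 1) * ∂ (powerSumSeries (n + 1)))
        + ∂ (∂ (powerSumSeries (n + 1)))))
    (c := PowerSeries.X * (powerSumSeries n - powerSumSeries (n + 1)) + ((n : PowerSeries ℂ) + 1))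
    (by linear_combination h)
  have h'' := congrArg PowerSeries.constantCoeff h'
  simp only [map_add, map_sub, map_mul, map_pow, map_ofNat, map_natCast, map_one,
    PowerSeries.constantCoeff_X, d] at h''
  linear_combination h''

theorem powerSumSeries_coeff_two_of_eq_two {n : ℕ} (hn : n % 3 = 2) :
    4 * PowerSeries.coeff 2 (powerSumSeries n) = (n : ℂ) + 1 ∧
      4 * PowerSeries.coeff 2 (powerSumSeries (n + 1)) = -((n : ℂ) + 1) := by
  have hs := powerSumSeries_coeff_two_sub hn
  have h1 := powerSumSeries_coeff_two_eq_or (n := n) (by omega)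
  have h2 := powerSumSeries_coeff_two_eq_or (n := n + 1) (by omega)
  push_cast at h2
  -- Each of the other three choices of roots would make a positive integer vanish.
  rcases h1 with h1 | h1 <;> rcases h2 with h2 | h2
  · have : (2 * n + 3 : ℂ) = 0 := by linear_combination -2 * hs + h1 - h2
    exact absurd this (by exact_mod_cast (by omega : 2 * n + 3 ≠ 0))
  · exact ⟨h1, h2⟩
  · have : (4 * n + 4 : ℂ) = 0 := by linear_combination -2 * hs + h1 - h2
    exact absurd this (by exact_mod_cast (by omega : 4 * n + 4 ≠ 0))
  · have : (2 * n + 1 : ℂ) = 0 := by linear_combination -2 * hs + h1 - h2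
    exact absurd this (by exact_mod_cast (by omega : 2 * n + 1 ≠ 0))

theorem powerSumSeries_coeff_two_of_eq_zero {n : ℕ} (hn : n % 3 = 0) :
    4 * PowerSeries.coeff 2 (powerSumSeries n) = -(n : ℂ) := by
  rcases n with _ | n
  · simp [powerSumSeries, inversePowerSum, yablonskiiVorobev]
  · push_cast
    exact (powerSumSeries_coeff_two_of_eq_two (by omega)).2

end DifferentialEquation

/-! ### Polynomial dependence on `n` and the first coefficients. -/

section PolynomialDependence

/-- On the residue class of `r` modulo `3`, the function `c` is a rational polynomial. -/
def IsPolynomialOnClass (r : ℕ) (c : ℕ → ℂ) : Prop :=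
  ∃ P : ℚ[X], ∀ n : ℕ, n % 3 = r → c n = ((P.eval (n : ℚ) : ℚ) : ℂ)

namespace IsPolynomialOnClass

variable {r : ℕ} {c d : ℕ → ℂ}

theorem congr (hc : IsPolynomialOnClass r c) (h : ∀ n, n % 3 = r → d n = c n) :
    IsPolynomialOnClass r d :=
  hc.imp fun _ hP n hn => (h n hn).trans (hP n hn)

theorem const (q : ℚ) : IsPolynomialOnClass r fun _ => (q : ℂ) :=
  ⟨C q, fun n _ => by simp⟩

theorem add (hc : IsPolynomialOnClass r c) (hd : IsPolynomialOnClass r d) :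
    IsPolynomialOnClass r fun n => c n + d n := by
  obtain ⟨P, hP⟩ := hc
  obtain ⟨Q, hQ⟩ := hd
  exact ⟨P + Q, fun n hn => by
    simp only [hP n hn, hQ n hn, eval_add, Rat.cast_add]⟩

theorem mul (hc : IsPolynomialOnClass r c) (hd : IsPolynomialOnClass r d) :
    IsPolynomialOnClass r fun n => c n * d n := by
  obtain ⟨P, hP⟩ := hc
  obtain ⟨Q, hQ⟩ := hd
  exact ⟨P * Q, fun n hn => by
    simp only [hP n hn, hQ n hn, eval_mul, Rat.cast_mul]⟩

theorem sum {ι : Type*} {s : Finset ι} {c : ι → ℕ → ℂ}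
    (h : ∀ i ∈ s, IsPolynomialOnClass r (c i)) :
    IsPolynomialOnClass r fun n => ∑ i ∈ s, c i n := by
  classical
  induction s using Finset.induction with
  | empty => exact (const 0).congr fun n _ => by simp
  | insert i s hi ih =>
    refine ((h i (Finset.mem_insert_self i s)).add
      (ih fun j hj => h j (Finset.mem_insert_of_mem hj))).congr fun n _ => ?_
    rw [Finset.sum_insert hi]

end IsPolynomialOnClass

/-- The quadratic recursion satisfied by the coefficients preserves polynomial dependence. -/
theorem isPolynomialOnClass_recursion {r k : ℕ} (q : ℚ)
    (h : ∀ m < k + 3, IsPolynomialOnClass r fun n => PowerSeries.coeff m (powerSumSeries n)) :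
    IsPolynomialOnClass r fun n => (q : ℂ) * ((k + 1) * PowerSeries.coeff k (powerSumSeries n)
      - 6 * ∑ x ∈ Finset.HasAntidiagonal.antidiagonal k,
        (PowerSeries.coeff (x.1 + 1) (powerSumSeries n) * (x.1 + 1)) *
          (PowerSeries.coeff (x.2 + 1) (powerSumSeries n) * (x.2 + 1))) := by
  refine ((IsPolynomialOnClass.const q).mul (((IsPolynomialOnClass.const (k + 1)).mul
    (h k (by omega))).add ((IsPolynomialOnClass.const (-6)).mul
    (IsPolynomialOnClass.sum (s := Finset.HasAntidiagonal.antidiagonal k) (c := fun x n =>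
      (PowerSeries.coeff (x.1 + 1) (powerSumSeries n) * ((x.1 + 1 : ℚ) : ℂ)) *
        (PowerSeries.coeff (x.2 + 1) (powerSumSeries n) * ((x.2 + 1 : ℚ) : ℂ)))
      fun x hx => ?_)))).congr fun n _ => ?_
  · rw [Finset.HasAntidiagonal.mem_antidiagonal] at hx
    exact ((h _ (by omega)).mul (.const _)).mul ((h _ (by omega)).mul (.const _))
  · push_cast; ring

theorem isPolynomialOnClass_coeff {r : ℕ} (hr : r < 3) (m : ℕ) :
    IsPolynomialOnClass r fun n => PowerSeries.coeff m (powerSumSeries n) := by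
  induction m using Nat.strong_induction_on with
  | _ m ih =>
    rcases m with _ | _ | _ | k
    · exact (IsPolynomialOnClass.const 0).congr fun n _ => by
        rw [coeff_powerSumSeries_eq_zero (by norm_num), Rat.cast_zero]
    · exact (IsPolynomialOnClass.const 0).congr fun n _ => by
        rw [coeff_powerSumSeries_eq_zero (by norm_num), Rat.cast_zero]
    · interval_cases r
      · refine ⟨C (-1 / 4) * X, fun n hn => ?_⟩
        simp
        linear_combination powerSumSeries_coeff_two_of_eq_zero hn / 4
      · exact ⟨0, fun n hn => by simpa using powerSumSeries_coeff_two_of_eq hn⟩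
      · refine ⟨C (1 / 4) * (X + 1), fun n hn => ?_⟩
        simp
        linear_combination (powerSumSeries_coeff_two_of_eq_two hn).1 / 4
    · by_cases hr1 : r = 1
      · subst hr1
        -- The resonance: coefficient `5` comes from the sigma form instead.
        by_cases hk : k = 2
        · subst hk
          refine ⟨C (1 / 560) * (X * (X + 1) - 2), fun n hn => ?_⟩
          simp
          linear_combination powerSumSeries_coeff_five_of_eq hn / 560
        · refine (isPolynomialOnClass_recursion (k := k) (((k + 5) * (k - 2) * (k + 3))⁻¹ : ℚ)
            ih).congr fun n hn => ?_
          rw [← powerSumSeries_ode_of_eq_coeff hn]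
          push_cast
          have h1 : (k : ℂ) + 5 ≠ 0 := by exact_mod_cast (by omega : k + 5 ≠ 0)
          have h2 : (k : ℂ) - 2 ≠ 0 := sub_ne_zero.2 (by exact_mod_cast hk)
          have h3 : (k : ℂ) + 3 ≠ 0 := by exact_mod_cast (by omega : k + 3 ≠ 0)
          field_simp
      · refine (isPolynomialOnClass_recursion (k := k) (((k + 1) * (k + 2) * (k + 3))⁻¹ : ℚ)
          ih).congr fun n hn => ?_
        rw [← powerSumSeries_ode_of_ne_coeff (by omega)]
        push_cast
        have h1 : (k : ℂ) + 1 ≠ 0 := by exact_mod_cast (by omega : k + 1 ≠ 0)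
        have h2 : (k : ℂ) + 2 ≠ 0 := by exact_mod_cast (by omega : k + 2 ≠ 0)
        have h3 : (k : ℂ) + 3 ≠ 0 := by exact_mod_cast (by omega : k + 3 ≠ 0)
        field_simp

theorem inversePowerSum_eq_neg_coeff (n m : ℕ) :
    inversePowerSum n (m + 1) = -PowerSeries.coeff m (powerSumSeries n) := by
  rw [powerSumSeries, PowerSeries.coeff_mk, neg_neg]

theorem isPolynomialOnClass_inversePowerSum {r m : ℕ} (hr : r < 3) (hm : 0 < m) :
    IsPolynomialOnClass r fun n => inversePowerSum n m := by
  obtain ⟨m, rfl⟩ := Nat.exists_eq_add_of_lt hm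
  refine ((IsPolynomialOnClass.const (-1)).mul (isPolynomialOnClass_coeff hr m)).congr fun n _ => ?_
  rw [zero_add, inversePowerSum_eq_neg_coeff]
  push_cast; ring

theorem powerSumSeries_coeff_five_of_ne {n : ℕ} (hn : n % 3 ≠ 1) :
    20 * PowerSeries.coeff 5 (powerSumSeries n) = PowerSeries.coeff 2 (powerSumSeries n)
      - 8 * PowerSeries.coeff 2 (powerSumSeries n) ^ 2 := by
  have h := powerSumSeries_ode_of_ne_coeff hn 2
  simp [Finset.Nat.sum_antidiagonal_succ,
    coeff_powerSumSeries_eq_zero (show ¬ 3 ∣ 1 + 1 by norm_num) n] at h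
  linear_combination h / 3

/-- In the convolution only the index pairs `(1, 4)` and `(4, 1)` survive the vanishing mod 3. -/
theorem powerSumSeries_coeff_eight_of_ne {n : ℕ} (hn : n % 3 ≠ 1) :
    56 * PowerSeries.coeff 8 (powerSumSeries n) = PowerSeries.coeff 5 (powerSumSeries n)
      - 20 * PowerSeries.coeff 2 (powerSumSeries n) * PowerSeries.coeff 5 (powerSumSeries n) := by
  have h := powerSumSeries_ode_of_ne_coeff hn 5
  simp [Finset.Nat.sum_antidiagonal_succ,
    coeff_powerSumSeries_eq_zero (show ¬ 3 ∣ 1 + 1 by norm_num) n,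
    coeff_powerSumSeries_eq_zero (show ¬ 3 ∣ 3 + 1 by norm_num) n] at h
  linear_combination h / 6

theorem powerSumSeries_coeff_eight_of_eq {n : ℕ} (hn : n % 3 = 1) :
    40 * PowerSeries.coeff 8 (powerSumSeries n) = PowerSeries.coeff 5 (powerSumSeries n) := by
  have h := powerSumSeries_ode_of_eq_coeff hn 5
  simp [Finset.Nat.sum_antidiagonal_succ, powerSumSeries_coeff_two_of_eq hn,
    coeff_powerSumSeries_eq_zero (show ¬ 3 ∣ 1 + 1 by norm_num) n,
    coeff_powerSumSeries_eq_zero (show ¬ 3 ∣ 3 + 1 by norm_num) n] at h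
  linear_combination h / 6

end PolynomialDependence

/-! ### Closed formulas and rationality. -/

theorem mainTheorem5 :
    -- the division in the recurrence is exact, for every `n`
    (∀ n : ℕ, yablonskiiVorobev (n + 2) * yablonskiiVorobev n =
      X * yablonskiiVorobev (n + 1) ^ 2
        - 4 * (yablonskiiVorobev (n + 1) * derivative (derivative (yablonskiiVorobev (n + 1)))
          - derivative (yablonskiiVorobev (n + 1)) ^ 2)) ∧
    -- inverse third powers
    (∀ n : ℕ,
      (n ≡ 0 [MOD 3] → inversePowerSum n 3 = (n : ℂ) / 4) ∧
      (n ≡ 1 [MOD 3] → inversePowerSum n 3 = 0) ∧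
      (n ≡ 2 [MOD 3] → inversePowerSum n 3 = -((n : ℂ) + 1) / 4)) ∧
    -- inverse sixth powers
    (∀ n : ℕ,
      (n ≡ 0 [MOD 3] → inversePowerSum n 6 = 1 / 40 * (n : ℂ) ^ 2 + 1 / 80 * (n : ℂ)) ∧
      (n ≡ 1 [MOD 3] → inversePowerSum n 6 =
        -(1 / 560) * (n : ℂ) ^ 2 - 1 / 560 * (n : ℂ) + 1 / 280) ∧
      (n ≡ 2 [MOD 3] → inversePowerSum n 6 =
        1 / 40 * (n : ℂ) ^ 2 + 3 / 80 * (n : ℂ) + 1 / 80)) ∧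
    -- inverse ninth powers
    (∀ n : ℕ,
      (n ≡ 0 [MOD 3] → inversePowerSum n 9 =
        ((n : ℂ) + 7 * (n : ℂ) ^ 2 + 10 * (n : ℂ) ^ 3) / 4480) ∧
      (n ≡ 1 [MOD 3] → inversePowerSum n 9 = (2 - (n : ℂ) - (n : ℂ) ^ 2) / 22400) ∧
      (n ≡ 2 [MOD 3] → inversePowerSum n 9 =
        (-20 - 85 * (n : ℂ) - 115 * (n : ℂ) ^ 2 - 50 * (n : ℂ) ^ 3) / 22400)) ∧
    -- for every positive multiple `m` of `3`: a rational polynomial in `n` for each class mod `3`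
    (∀ m : ℕ, 0 < m → 3 ∣ m → ∀ r : ℕ, r < 3 → ∃ P : ℚ[X], ∀ n : ℕ, n ≡ r [MOD 3] →
      inversePowerSum n m = ((P.eval (n : ℚ) : ℚ) : ℂ)) ∧
    -- for `m` not divisible by `3` the sum vanishes
    (∀ m : ℕ, ¬ 3 ∣ m → ∀ n : ℕ, inversePowerSum n m = 0) ∧
    -- all sums are rational
    (∀ n m : ℕ, ∃ q : ℚ, inversePowerSum n m = (q : ℂ)) := by
  refine ⟨yablonskiiVorobev_recurrence, fun n => ⟨fun hn => ?_, fun hn => ?_, fun hn => ?_⟩,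
    fun n => ⟨fun hn => ?_, fun hn => ?_, fun hn => ?_⟩,
    fun n => ⟨fun hn => ?_, fun hn => ?_, fun hn => ?_⟩, fun m hm _ r hr => ?_,
    fun m hm n => inversePowerSum_eq_zero_of_not_dvd hm n, fun n m => ?_⟩
  · replace hn : n % 3 = 0 := hn
    rw [inversePowerSum_eq_neg_coeff]
    linear_combination -powerSumSeries_coeff_two_of_eq_zero hn / 4
  · replace hn : n % 3 = 1 := hn
    rw [inversePowerSum_eq_neg_coeff, powerSumSeries_coeff_two_of_eq hn, neg_zero]
  · replace hn : n % 3 = 2 := hn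
    rw [inversePowerSum_eq_neg_coeff]
    linear_combination -(powerSumSeries_coeff_two_of_eq_two hn).1 / 4
  · replace hn : n % 3 = 0 := hn
    have h2 : PowerSeries.coeff 2 (powerSumSeries n) = -(n : ℂ) / 4 := by
      linear_combination powerSumSeries_coeff_two_of_eq_zero hn / 4
    have h5 := powerSumSeries_coeff_five_of_ne (n := n) (by omega)
    rw [inversePowerSum_eq_neg_coeff]
    rw [h2] at h5
    linear_combination -h5 / 20
  · replace hn : n % 3 = 1 := hn
    rw [inversePowerSum_eq_neg_coeff]
    linear_combination -powerSumSeries_coeff_five_of_eq hn / 560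
  · replace hn : n % 3 = 2 := hn
    have h2 : PowerSeries.coeff 2 (powerSumSeries n) = ((n : ℂ) + 1) / 4 := by
      linear_combination (powerSumSeries_coeff_two_of_eq_two hn).1 / 4
    have h5 := powerSumSeries_coeff_five_of_ne (n := n) (by omega)
    rw [inversePowerSum_eq_neg_coeff]
    rw [h2] at h5
    linear_combination -h5 / 20
  · replace hn : n % 3 = 0 := hn
    have h2 : PowerSeries.coeff 2 (powerSumSeries n) = -(n : ℂ) / 4 := by
      linear_combination powerSumSeries_coeff_two_of_eq_zero hn / 4
    have h5 := powerSumSeries_coeff_five_of_ne (n := n) (by omega)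
    have h8 := powerSumSeries_coeff_eight_of_ne (n := n) (by omega)
    rw [inversePowerSum_eq_neg_coeff]
    rw [h2] at h5 h8
    -- The weight of `h5` is `(1 - 20a₂) / (56 · 20)` with `a₂ = -n/4`.
    linear_combination -h8 / 56 - (1 + 5 * (n : ℂ)) / 1120 * h5
  · replace hn : n % 3 = 1 := hn
    rw [inversePowerSum_eq_neg_coeff]
    linear_combination -powerSumSeries_coeff_eight_of_eq hn / 40
      - powerSumSeries_coeff_five_of_eq hn / 22400
  · replace hn : n % 3 = 2 := hn
    have h2 : PowerSeries.coeff 2 (powerSumSeries n) = ((n : ℂ) + 1) / 4 := by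
      linear_combination (powerSumSeries_coeff_two_of_eq_two hn).1 / 4
    have h5 := powerSumSeries_coeff_five_of_ne (n := n) (by omega)
    have h8 := powerSumSeries_coeff_eight_of_ne (n := n) (by omega)
    rw [inversePowerSum_eq_neg_coeff]
    rw [h2] at h5 h8
    linear_combination -h8 / 56 - (1 - 5 * ((n : ℂ) + 1)) / 1120 * h5
  · obtain ⟨P, hP⟩ := isPolynomialOnClass_inversePowerSum hr hm
    exact ⟨P, fun n hn => hP n (Eq.trans hn (Nat.mod_eq_of_lt hr))⟩
  · rcases Nat.eq_zero_or_pos m with rfl | hm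
    -- For exponent `0` the sum is the number of nonzero roots.
    · exact ⟨Multiset.card (((yablonskiiVorobev n).aroots ℂ).filter fun z : ℂ => z ≠ 0), by
        simp [inversePowerSum]⟩
    · obtain ⟨P, hP⟩ := isPolynomialOnClass_inversePowerSum (Nat.mod_lt n (by norm_num : 3 > 0)) hm
      exact ⟨_, hP n rfl⟩
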